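/- Let $n\ge 3$. For an open interval $I\subset\mathbb R$ and smooth functions $a,k:I\to\mathbb R$ with $a>0$, consider the following Lorentzian metrics on open subsets of $I\times\mathbb R^n$, written in polar coordinates $(r,\theta)$ of $\mathbb R^n$, with $g_{\mathbb S}$ the round metric of the unit sphere $\mathbb S^{n-1}$ and $1/\sqrt C:=\infty$ for $C\le 0$: - the $k(t)$-warped metric $-dt^2+a(t)^2\big(dr^2+S_{k(t)}(r)^2 g_{\mathbb S}\big)$ on $\{t\in I,\ 0<r<\pi/\sqrt{k(t)}\}$, where $S_k(r)=\sin(\sqrt k\,r)/\sqrt k$, $r$, $\sinh(\sqrt{-k}\,r)/\sqrt{-k}$ for $k>0$, $k=0$, $k<0$ respectively; - the $k(t)$-conformal metric $-dt^2+\frac{4a(t)^2}{(1+k(t)r^2)^2}\big(dr^2+r^2g_{\mathbb S}\big)$ on $\{t\in I,\ 0<r<1/\sqrt{-k(t)}\}$; - the $k(t)$-radial metric $-dt^2+a(t)^2\big(\frac{dr^2}{1-k(t)r^2}+r^2g_{\mathbb S}\big)$ on $\{t\in I,\ 0<r<1/\sqrt{k(t)}\}$. Let $(I_1,a_1,k_1)$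 and $(I_2,a_2,k_2)$ be two such data (possibly equal), and suppose that $\dot k_2(t)\neq 0$ for all $t\in I_2$. Then: 1. The $k(t)$-conformal metric of $(I_1,a_1,k_1)$ is not locally isometric to the $k(t)$-radial or to the $k(t)$-warped metric of $(I_2,a_2,k_2)$: no nonempty open subset of the first space is isometric to an open subset of either of the other two. 2. The $k(t)$-conformal metric of $(I_1,a_1,k_1)$ is locally conformally flat (around each point it is, in suitable coordinates, a positive smooth multiple of the Minkowski metric), and its Weyl tensor vanishes identically. 3. The $k(t)$-radial and the $k(t)$-warped metrics of $(I_2,a_2,k_2)$ are not locally conformally flat on any nonempty open subset of their domains. -/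

import Mathlib

open scoped ContDiff

namespace KMetric

noncomputable section

/-- Cartesian coordinates `(t, x¹, …, xⁿ)` of `ℝ × ℝⁿ`; the index `0` is the time coordinate. The
same type serves as the tangent space at each point. -/
abbrev Point (n : ℕ) : Type := Fin (n + 1) → ℝ

/-- A field of bilinear forms in these coordinates: `g p v w` is the value of `g` at the point `p`
on the tangent vectors `v` and `w`. -/
abbrev TensorField (n : ℕ) : Type := Point n → Point n → Point n → ℝ

/-! ### The three metrics -/

/-- The radial coordinate `r = |x|`. -/
def radius {n : ℕ} (p : Point n) : ℝ := √(∑ i : Fin n, p i.succ ^ 2)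

/-- The one-form `dr`, that is `∑ xⁱ dxⁱ / r`. -/
def dr {n : ℕ} (p v : Point n) : ℝ := (∑ i : Fin n, p i.succ * v i.succ) / radius p

/-- The round metric of the unit sphere in polar coordinates, that is its pullback under
`x ↦ x / r`; it is determined by `∑ (dxⁱ)² = dr² + r² g_S`. -/
def sphereMetric {n : ℕ} : TensorField n := fun p v w =>
  ((∑ i : Fin n, v i.succ * w i.succ) - dr p v * dr p w) / radius p ^ 2

/-- The function `S_k`. -/
def S (k χ : ℝ) : ℝ :=
  if 0 < k then Real.sin (√k * χ) / √k
  else if k = 0 then χ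
  else Real.sinh (√(-k) * χ) / √(-k)

/-- The `k(t)`-warped metric `-dt² + a² (dr² + S_k(r)² g_S)`. -/
def warped (n : ℕ) (a k : ℝ → ℝ) : TensorField n := fun p v w =>
  -(v 0 * w 0) + a (p 0) ^ 2 *
    (dr p v * dr p w + S (k (p 0)) (radius p) ^ 2 * sphereMetric p v w)

/-- The domain `t ∈ I`, `0 < r < π / √k(t)` (the upper bound being `∞` if `k(t) ≤ 0`). -/
def warpedDomain (n : ℕ) (I : Set ℝ) (k : ℝ → ℝ) : Set (Point n) :=
  {p | p 0 ∈ I ∧ 0 < radius p ∧ (0 < k (p 0) → radius p < Real.pi / √(k (p 0)))}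

/-- The `k(t)`-conformal metric `-dt² + 4 a² / (1 + k r²)² (dr² + r² g_S)`. -/
def conformal (n : ℕ) (a k : ℝ → ℝ) : TensorField n := fun p v w =>
  -(v 0 * w 0) + 4 * a (p 0) ^ 2 / (1 + k (p 0) * radius p ^ 2) ^ 2 *
    (dr p v * dr p w + radius p ^ 2 * sphereMetric p v w)

/-- The domain `t ∈ I`, `0 < r < 1 / √(-k(t))` (the upper bound being `∞` if `k(t) ≥ 0`). -/
def conformalDomain (n : ℕ) (I : Set ℝ) (k : ℝ → ℝ) : Set (Point n) :=
  {p | p 0 ∈ I ∧ 0 < radius p ∧ (k (p 0) < 0 → radius p < 1 / √(-k (p 0)))}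

/-- The `k(t)`-radial metric `-dt² + a² (dr² / (1 - k r²) + r² g_S)`. -/
def radial (n : ℕ) (a k : ℝ → ℝ) : TensorField n := fun p v w =>
  -(v 0 * w 0) + a (p 0) ^ 2 *
    (1 / (1 - k (p 0) * radius p ^ 2) * (dr p v * dr p w) + radius p ^ 2 * sphereMetric p v w)

/-- The domain `t ∈ I`, `0 < r < 1 / √k(t)` (the upper bound being `∞` if `k(t) ≤ 0`). -/
def radialDomain (n : ℕ) (I : Set ℝ) (k : ℝ → ℝ) : Set (Point n) :=
  {p | p 0 ∈ I ∧ 0 < radius p ∧ (0 < k (p 0) → radius p < 1 / √(k (p 0)))}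

/-- The data of a `k(t)` metric: an open interval `I` and smooth functions `a > 0` and `k` on it. -/
structure IsData (I : Set ℝ) (a k : ℝ → ℝ) : Prop where
  isOpen : IsOpen I
  ordConnected : I.OrdConnected
  smooth_a : ContDiffOn ℝ ∞ a I
  smooth_k : ContDiffOn ℝ ∞ k I
  pos_a : ∀ t ∈ I, 0 < a t

/-! ### Isometries and conformal flatness -/

/-- The pullback `φ^* g`. -/
def pullback {n : ℕ} (φ : Point n → Point n) (g : TensorField n) : TensorField n := fun p v w =>
  g (φ p) (fderiv ℝ φ p v) (fderiv ℝ φ p w)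

/-- `φ` is a smooth diffeomorphism from its (open) source onto its (open) target. -/
def IsDiffeo {n : ℕ} (φ : OpenPartialHomeomorph (Point n) (Point n)) : Prop :=
  ContDiffOn ℝ ∞ φ φ.source ∧ ContDiffOn ℝ ∞ φ.symm φ.target

/-- Some nonempty open subset of `(U₁, g₁)` is isometric to an open subset of `(U₂, g₂)`. -/
def HasLocalIsometry {n : ℕ} (g₁ : TensorField n) (U₁ : Set (Point n))
    (g₂ : TensorField n) (U₂ : Set (Point n)) : Prop :=
  ∃ φ : OpenPartialHomeomorph (Point n) (Point n), IsDiffeo φ ∧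
    φ.source.Nonempty ∧ φ.source ⊆ U₁ ∧ φ.target ⊆ U₂ ∧
    ∀ p ∈ φ.source, pullback φ g₂ p = g₁ p

/-- The Minkowski metric. -/
def minkowski (n : ℕ) : TensorField n := fun _ v w =>
  -(v 0 * w 0) + ∑ i : Fin n, v i.succ * w i.succ

/-- `(U, g)` is locally conformally flat: around each point of `U` there are coordinates in which
`g` is a positive smooth multiple of the Minkowski metric. -/
def LocallyConformallyFlat {n : ℕ} (g : TensorField n) (U : Set (Point n)) : Prop :=
  ∀ p ∈ U, ∃ (φ : OpenPartialHomeomorph (Point n) (Point n)) (Ω : Point n → ℝ),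
    IsDiffeo φ ∧ p ∈ φ.source ∧ φ.source ⊆ U ∧
    ContDiffOn ℝ ∞ Ω φ.source ∧
    ∀ q ∈ φ.source, 0 < Ω q ∧ ∀ v w, g q v w = Ω q * pullback φ (minkowski n) q v w

/-! ### The Weyl tensor in the coordinates `(t, x¹, …, xⁿ)` -/

/-- The matrix of components of `g` at `p`. -/
def comp {n : ℕ} (g : TensorField n) (p : Point n) : Matrix (Fin (n + 1)) (Fin (n + 1)) ℝ :=
  Matrix.of fun i j => g p (Pi.single i 1) (Pi.single j 1)

/-- The partial derivative `∂_i F`. -/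
def pd {n : ℕ} (i : Fin (n + 1)) (F : Point n → ℝ) (p : Point n) : ℝ :=
  fderiv ℝ F p (Pi.single i 1)

/-- The Christoffel symbol `Γ^d_{bc}`. -/
def christoffel {n : ℕ} (g : TensorField n) (d b c : Fin (n + 1)) (p : Point n) : ℝ :=
  1 / 2 * ∑ s, (comp g p)⁻¹ d s *
    (pd b (fun q => comp g q s c) p + pd c (fun q => comp g q s b) p
      - pd s (fun q => comp g q b c) p)

/-- The curvature tensor `R_{abc}^d`, with `[∇_a, ∇_b] V^d = - R_{abc}^d V^c`. -/
def riemannUp {n : ℕ} (g : TensorField n) (a b c d : Fin (n + 1)) (p : Point n) : ℝ :=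
  pd b (christoffel g d a c) p - pd a (christoffel g d b c) p
    + ∑ e, (christoffel g e a c p * christoffel g d e b p
      - christoffel g e b c p * christoffel g d e a p)

/-- The curvature tensor `R_{abcd}`. -/
def riemann {n : ℕ} (g : TensorField n) (a b c d : Fin (n + 1)) (p : Point n) : ℝ :=
  ∑ e, comp g p d e * riemannUp g a b c e p

/-- The Ricci tensor `R_{ab} = R_{acb}^c`. -/
def ricci {n : ℕ} (g : TensorField n) (a b : Fin (n + 1)) (p : Point n) : ℝ :=
  ∑ c, riemannUp g a c b c p

/-- The scalar curvature. -/
def scalar {n : ℕ} (g : TensorField n) (p : Point n) : ℝ :=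
  ∑ a, ∑ b, (comp g p)⁻¹ a b * ricci g a b p

/-- The Weyl tensor `C_{abcd}` in `n + 1` dimensions. -/
def weyl {n : ℕ} (g : TensorField n) (a b c d : Fin (n + 1)) (p : Point n) : ℝ :=
  riemann g a b c d p
    - 1 / ((n : ℝ) - 1) *
      (comp g p a c * ricci g d b p - comp g p a d * ricci g c b p
        - comp g p b c * ricci g d a p + comp g p b d * ricci g c a p)
    + scalar g p / ((n : ℝ) * ((n : ℝ) - 1)) *
      (comp g p a c * comp g p d b - comp g p a d * comp g p c b)

end

end KMetric

/-!
Local conformal flatness of the three metrics is decided through the classical description of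
conformally flat metrics as sections of a light cone.

If `g = Ω φ^* η` with `η` the Minkowski metric, then `Φ = √Ω (φ, 1, η(φ, φ))` maps the domain
isometrically into the null cone of the form `η - ds₁ ds₂` on `ℝ^{n+3}` (`exists_isNullLift`). The
normal bundle of `Φ` is a hyperbolic plane, one of whose null directions is `Φ` itself, and the
component of the second fundamental form paired with `Φ` is `-g`. The Gauss equation
(`IsNullLift.riemann_eq`) therefore exhibits the curvature tensor as a Kulkarni–Nomizu product of
`g` with a symmetric tensor `P` (`IsNullLift.exists_riemann_eq`), and taking traces shows that the
Weyl tensor vanishes (`IsNullLift.weyl_eq_zero`).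

The conformal metric is `4a²/(1 + k r²)²` times `-((1 + k r²)/(2a))² dt² + |dx|²`. In the `(t, r)`
plane the null directions of the latter are `dr = ± (α + β r²) dt` with `α = 1/(2a)` and
`β = k/(2a)`: Riccati equations, which are integrated by a curve of Möbius transformations. Letting
these act on the light-cone coordinates `± r` gives explicit coordinates in which the metric is
conformal to Minkowski space (`pullback_mobiusMap`, `locallyConformallyFlat_conformal`).

For the two negative results, the same curvature formula implies that for orthonormal
`t, e, f, f'` the sectional curvatures of a conformally flat metric satisfy
`K(t, f) + K(e, f') = K(t, e) + K(f, f')`. With `e` radial and `f`, `f'` angular (here `n ≥ 3` is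
used) this is worked out for all metrics `-dt² + u |dx|² + w (x · dx)²`
(`IsNullLift.spherical_identity`). For the radial metric it is, at each time, an affine equation in
`r²` which cannot hold for two values of `r` when `k` is not stationary (`radial_identity`). For the
warped metric it is an algebraic relation between `r` and `y = r S_k'(r) / S_k(r)`
(`warped_identity`), incompatible with the Riccati equation satisfied by `y`
(`riccati_contradiction`). Since local conformal flatness is invariant under isometries
(`LocallyConformallyFlat.of_isometry`), there is no local isometry from the conformal metric to
either of the other two.
-/

namespace KMetric

open Filter Topology

/-! ### Derivatives along constant vector fields -/

section Along

variable {E F G H : Type*} [NormedAddCommGroup E] [NormedSpace ℝ E]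
  [NormedAddCommGroup F] [NormedSpace ℝ F] [NormedAddCommGroup G] [NormedSpace ℝ G]
  [NormedAddCommGroup H] [NormedSpace ℝ H]

/-- The derivative of `f` along the constant vector field `v`. -/
noncomputable def along (v : E) (f : E → F) : E → F := fun p => fderiv ℝ f p v

theorem along_congr {v : E} {f g : E → F} {p : E} (h : f =ᶠ[𝓝 p] g) :
    along v f p = along v g p := by
  simp only [along, h.fderiv_eq]

theorem differentiableAt_of_contDiffOn {f : E → F} {U : Set E} (hU : IsOpen U)
    (hf : ContDiffOn ℝ ∞ f U) {p : E} (hp : p ∈ U) : DifferentiableAt ℝ f p :=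
  (hf.contDiffAt (hU.mem_nhds hp)).differentiableAt (by simp)

theorem contDiffOn_fderiv {f : E → F} {U : Set E} (hU : IsOpen U)
    (hf : ContDiffOn ℝ ∞ f U) : ContDiffOn ℝ ∞ (fderiv ℝ f) U :=
  hf.fderiv_of_isOpen hU (by simp)

theorem contDiffOn_along {f : E → F} {U : Set E} (hU : IsOpen U)
    (hf : ContDiffOn ℝ ∞ f U) (v : E) : ContDiffOn ℝ ∞ (along v f) U :=
  (contDiffOn_fderiv hU hf).clm_apply contDiffOn_const

theorem along_comm {f : E → F} {U : Set E} (hU : IsOpen U)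
    (hf : ContDiffOn ℝ ∞ f U) {p : E} (hp : p ∈ U) (v w : E) :
    along v (along w f) p = along w (along v f) p := by
  have hs : IsSymmSndFDerivAt ℝ f p :=
    (hf.contDiffAt (hU.mem_nhds hp)).isSymmSndFDerivAt (by
      rw [minSmoothness_of_isRCLikeNormedField]
      exact ENat.LEInfty.out)
  have hd := differentiableAt_of_contDiffOn hU (contDiffOn_fderiv hU hf) hp
  have key : ∀ a b : E, along a (along b f) p = fderiv ℝ (fderiv ℝ f) p a b := by
    intro a b
    have := (hd.hasFDerivAt.clm_apply (hasFDerivAt_const b p)).fderiv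
    change fderiv ℝ (fun q => fderiv ℝ f q b) p a = _
    rw [this]
    simp
  rw [key, key]
  exact hs v w

theorem along_bilin (B : F →L[ℝ] G →L[ℝ] H) {f : E → F} {g : E → G} {p : E}
    (hf : DifferentiableAt ℝ f p) (hg : DifferentiableAt ℝ g p) (v : E) :
    along v (fun q => B (f q) (g q)) p = B (along v f p) (g p) + B (f p) (along v g p) := by
  simp only [along]
  rw [(B.hasFDerivAt_of_bilinear hf.hasFDerivAt hg.hasFDerivAt).fderiv]
  simp [add_comm]

theorem along_smul {c : E → ℝ} {f : E → F} {p : E}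
    (hc : DifferentiableAt ℝ c p) (hf : DifferentiableAt ℝ f p) (v : E) :
    along v (fun q => c q • f q) p = along v c p • f p + c p • along v f p := by
  simp only [along]
  rw [fderiv_fun_smul hc hf]
  simp [add_comm]

theorem along_add {f g : E → F} {p : E}
    (hf : DifferentiableAt ℝ f p) (hg : DifferentiableAt ℝ g p) (v : E) :
    along v (fun q => f q + g q) p = along v f p + along v g p := by
  simp only [along]
  rw [fderiv_fun_add hf hg]
  simp

theorem along_sum {ι : Type*} {s : Finset ι} {f : ι → E → F} {p : E}
    (hf : ∀ i ∈ s, DifferentiableAt ℝ (f i) p) (v : E) :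
    along v (fun q => ∑ i ∈ s, f i q) p = ∑ i ∈ s, along v (f i) p := by
  simp only [along]
  rw [fderiv_fun_sum hf]
  simp

theorem contDiffOn_bilin (B : F →L[ℝ] G →L[ℝ] H) {f : E → F} {g : E → G} {U : Set E}
    (hf : ContDiffOn ℝ ∞ f U) (hg : ContDiffOn ℝ ∞ g U) :
    ContDiffOn ℝ ∞ (fun q => B (f q) (g q)) U :=
  B.isBoundedBilinearMap.contDiff.comp_contDiffOn (hf.prodMk hg)

/-- A derivative along `v` can be read off on the line `s ↦ p + s v`. -/
theorem along_eq_of_line {f : E → F} {p v : E} {c : ℝ → F} {c' : F}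
    (hf : DifferentiableAt ℝ f p) (hc : HasDerivAt c c' 0)
    (h : (fun s : ℝ => f (p + s • v)) =ᶠ[𝓝 0] c) : along v f p = c' := by
  have hl : HasDerivAt (fun s : ℝ => p + s • v) v 0 := by
    simpa using ((hasDerivAt_id (0 : ℝ)).smul_const v).const_add p
  have h1 : HasDerivAt (fun s : ℝ => f (p + s • v)) (along v f p) 0 := by
    have h0 : HasFDerivAt f (fderiv ℝ f p) (p + (0 : ℝ) • v) := by simpa using hf.hasFDerivAt
    exact h0.comp_hasDerivAt (0 : ℝ) hl
  exact (h1.congr_of_eventuallyEq h.symm).unique hc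

theorem eventually_line {U : Set E} (hU : IsOpen U) {p : E} (hp : p ∈ U) (v : E) :
    ∀ᶠ s : ℝ in 𝓝 0, p + s • v ∈ U := by
  have hc : ContinuousAt (fun s : ℝ => p + s • v) 0 := by fun_prop
  exact hc.eventually (hU.mem_nhds (by simpa using hp))

end Along

/-! ### Lifts to the null cone -/

section NullLift

variable {E F : Type*} [NormedAddCommGroup F] [NormedSpace ℝ F]

/-- If `B` is nondegenerate on `range L`, which has codimension two, and `Φ` is a null vector
orthogonal to it, then the orthogonal complement of `range L` is a hyperbolic plane with a null
basis `Φ`, `N`, normalized by `B Φ N = 1`. The conclusion expresses `B` on this plane. -/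
theorem exists_null_normal [AddCommGroup E] [Module ℝ E] [FiniteDimensional ℝ E]
    [FiniteDimensional ℝ F]
    (B : F →L[ℝ] F →L[ℝ] ℝ) (hsymm : ∀ x y, B x y = B y x)
    (hnd : ∀ x, (∀ y, B x y = 0) → x = 0)
    (hdim : Module.finrank ℝ F = Module.finrank ℝ E + 2)
    (L : E →ₗ[ℝ] F) (hL : ∀ v, (∀ w, B (L v) (L w) = 0) → v = 0)
    (Φ : F) (hΦ : Φ ≠ 0) (hnull : B Φ Φ = 0) (horth : ∀ v, B Φ (L v) = 0) :
    ∃ N : F, ∀ h₁ h₂ : F, (∀ v, B h₁ (L v) = 0) → (∀ v, B h₂ (L v) = 0) →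
      B h₁ h₂ = B h₁ N * B h₂ Φ + B h₁ Φ * B h₂ N := by
  -- pairing with `range L` and with `Φ`, as a linear map onto the dual of `E × ℝ`
  let J : E × ℝ →ₗ[ℝ] F := LinearMap.coprod L (LinearMap.toSpanSingleton ℝ F Φ)
  have hJ : ∀ v s, J (v, s) = L v + s • Φ := fun v s => by simp [J]
  let T : F →ₗ[ℝ] Module.Dual ℝ (E × ℝ) :=
    { toFun := fun h => (B h).toLinearMap ∘ₗ J
      map_add' := fun x y => by ext <;> simp
      map_smul' := fun c x => by ext <;> simp }
  have hT : ∀ h v s, T h (v, s) = B h (L v) + s * B h Φ := fun h v s => by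
    change B h (J (v, s)) = _
    simp [hJ]
  have hJinj : Function.Injective J := by
    rw [← LinearMap.ker_eq_bot, LinearMap.ker_eq_bot']
    rintro ⟨v, s⟩ h
    rw [hJ] at h
    have hv : v = 0 := hL v fun w => by
      have := congrArg (fun x => B x (L w)) h
      simpa [horth] using this
    subst hv
    have : s = 0 := by simpa [hΦ] using h
    simp [this]
  have hBsurj : Function.Surjective
      (LinearMap.toContinuousLinearMap.symm.toLinearMap ∘ₗ B.toLinearMap :
        F →ₗ[ℝ] Module.Dual ℝ F) := by
    apply (LinearMap.injective_iff_surjective_of_finrank_eq_finrank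
      (Subspace.dual_finrank_eq).symm).1
    rw [← LinearMap.ker_eq_bot, LinearMap.ker_eq_bot']
    intro x hx
    exact hnd x fun y => congrArg (fun l : Module.Dual ℝ F => l y) hx
  have hTsurj : Function.Surjective T := by
    intro l
    obtain ⟨l', hl'⟩ := LinearMap.dualMap_surjective_of_injective hJinj l
    obtain ⟨x, hx⟩ := hBsurj l'
    refine ⟨x, ?_⟩
    rw [← hl', ← hx]
    rfl
  have hker : Module.finrank ℝ (LinearMap.ker T) = 1 := by
    have h1 := LinearMap.finrank_range_add_finrank_ker T
    rw [LinearMap.range_eq_top.2 hTsurj, finrank_top, Subspace.dual_finrank_eq,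
      Module.finrank_prod, Module.finrank_self, hdim] at h1
    omega
  have hΦker : Φ ∈ LinearMap.ker T := by
    rw [LinearMap.mem_ker]
    ext v <;> simp [hT, horth, hnull]
  have hspan : ∀ x, (∀ v, B x (L v) = 0) → B x Φ = 0 → ∃ c : ℝ, x = c • Φ := by
    intro x hx hxΦ
    have hx' : x ∈ LinearMap.ker T := by
      rw [LinearMap.mem_ker]
      ext v <;> simp [hT, hx, hxΦ]
    obtain ⟨c, hc⟩ := (finrank_eq_one_iff_of_nonzero' (⟨Φ, hΦker⟩ : LinearMap.ker T)
      (by simpa using hΦ)).1 hker ⟨x, hx'⟩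
    exact ⟨c, by simpa using (congrArg Subtype.val hc).symm⟩
  obtain ⟨N₀, hN₀⟩ := hTsurj (LinearMap.snd ℝ E ℝ)
  have hN₀L : ∀ v, B N₀ (L v) = 0 := fun v => by
    have := congrArg (fun l : Module.Dual ℝ (E × ℝ) => l (v, 0)) hN₀
    simpa [hT] using this
  have hN₀Φ : B N₀ Φ = 1 := by
    have := congrArg (fun l : Module.Dual ℝ (E × ℝ) => l (0, 1)) hN₀
    simpa [hT] using this
  -- subtracting a multiple of `Φ` makes the dual vector `N₀` null
  set N := N₀ - (B N₀ N₀ / 2) • Φ with hN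
  have hNL : ∀ v, B N (L v) = 0 := fun v => by simp [hN, hN₀L, horth]
  have hNΦ : B N Φ = 1 := by simp [hN, hN₀Φ, hnull]
  have hNN : B N N = 0 := by
    simp only [hN, map_sub, map_smul, sub_apply,
      smul_apply, smul_eq_mul, hN₀Φ, hsymm Φ N₀, hnull]
    ring
  have hdec : ∀ h, (∀ v, B h (L v) = 0) → h = (B h N) • Φ + (B h Φ) • N := by
    intro h hh
    obtain ⟨c, hc⟩ := hspan (h - (B h Φ) • N) (fun v => by simp [hh, hNL]) (by simp [hNΦ])
    have h2 : B h N = c := by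
      have := congrArg (fun x => B x N) hc
      simpa [hNN, hsymm Φ N, hNΦ] using this
    rw [h2, ← hc]
    abel
  refine ⟨N, fun h₁ h₂ hh₁ hh₂ => ?_⟩
  conv_lhs => rw [hdec h₁ hh₁]
  simp [hsymm Φ h₂, hsymm N h₂]

end NullLift

/-- `Φ` maps the open set `U` isometrically, for the nondegenerate metric `g`, into the null cone
(without its vertex) of the nondegenerate symmetric form `B` on a space of dimension `n + 3`. -/
structure IsNullLift {n : ℕ} {F : Type*} [NormedAddCommGroup F] [NormedSpace ℝ F]
    (B : F →L[ℝ] F →L[ℝ] ℝ) (Φ : Point n → F) (g : TensorField n) (U : Set (Point n)) :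
    Prop where
  isOpen : IsOpen U
  symm : ∀ x y, B x y = B y x
  nondeg : ∀ x, (∀ y, B x y = 0) → x = 0
  finrank : Module.finrank ℝ F = n + 3
  smooth : ContDiffOn ℝ ∞ Φ U
  null : ∀ q ∈ U, B (Φ q) (Φ q) = 0
  ne_zero : ∀ q ∈ U, Φ q ≠ 0
  metric : ∀ q ∈ U, ∀ v w, B (along v Φ q) (along w Φ q) = g q v w
  nondeg_metric : ∀ q ∈ U, ∀ v, (∀ w, g q v w = 0) → v = 0

namespace IsNullLift

variable {n : ℕ} {F : Type*} [NormedAddCommGroup F] [NormedSpace ℝ F]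
  {B : F →L[ℝ] F →L[ℝ] ℝ} {Φ : Point n → F} {g : TensorField n} {U : Set (Point n)}

theorem mono {U' : Set (Point n)}
    (h : IsNullLift B Φ g U) (hU' : IsOpen U') (hsub : U' ⊆ U) : IsNullLift B Φ g U' where
  isOpen := hU'
  symm := h.symm
  nondeg := h.nondeg
  finrank := h.finrank
  smooth := h.smooth.mono hsub
  null := fun q hq => h.null q (hsub hq)
  ne_zero := fun q hq => h.ne_zero q (hsub hq)
  metric := fun q hq => h.metric q (hsub hq)
  nondeg_metric := fun q hq => h.nondeg_metric q (hsub hq)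

theorem smooth₁ (h : IsNullLift B Φ g U) (v : Point n) : ContDiffOn ℝ ∞ (along v Φ) U :=
  contDiffOn_along h.isOpen h.smooth v

theorem smooth₂ (h : IsNullLift B Φ g U) (v w : Point n) :
    ContDiffOn ℝ ∞ (along v (along w Φ)) U :=
  contDiffOn_along h.isOpen (h.smooth₁ w) v

theorem diff₀ (h : IsNullLift B Φ g U) {p : Point n} (hp : p ∈ U) :
    DifferentiableAt ℝ Φ p :=
  differentiableAt_of_contDiffOn h.isOpen h.smooth hp

theorem diff₁ (h : IsNullLift B Φ g U) {p : Point n} (hp : p ∈ U) (v : Point n) :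
    DifferentiableAt ℝ (along v Φ) p :=
  differentiableAt_of_contDiffOn h.isOpen (h.smooth₁ v) hp

theorem diff₂ (h : IsNullLift B Φ g U) {p : Point n} (hp : p ∈ U) (v w : Point n) :
    DifferentiableAt ℝ (along v (along w Φ)) p :=
  differentiableAt_of_contDiffOn h.isOpen (h.smooth₂ v w) hp

theorem comm₂ (h : IsNullLift B Φ g U) {p : Point n} (hp : p ∈ U) (v w : Point n) :
    along v (along w Φ) p = along w (along v Φ) p :=
  along_comm h.isOpen h.smooth hp v w

theorem comm₃ (h : IsNullLift B Φ g U) {p : Point n} (hp : p ∈ U) (v w z : Point n) :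
    along v (along w (along z Φ)) p = along w (along v (along z Φ)) p :=
  along_comm h.isOpen (h.smooth₁ z) hp v w

theorem along_eq_of_eqOn (h : IsNullLift B Φ g U) {p : Point n} (hp : p ∈ U)
    {f₁ f₂ : Point n → ℝ} (hf : ∀ q ∈ U, f₁ q = f₂ q) (v : Point n) :
    along v f₁ p = along v f₂ p :=
  along_congr (Filter.eventually_of_mem (h.isOpen.mem_nhds hp) hf)

/-- The position vector of a null lift is normal to it. -/
theorem orth (h : IsNullLift B Φ g U) {p : Point n} (hp : p ∈ U) (v : Point n) :
    B (Φ p) (along v Φ p) = 0 := by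
  have h1 := h.along_eq_of_eqOn hp h.null v
  rw [along_bilin B (h.diff₀ hp) (h.diff₀ hp), h.symm (along v Φ p)] at h1
  have : along v (fun _ : Point n => (0 : ℝ)) p = 0 := by simp [along]
  linarith

/-- The component of the second derivatives of a null lift on the null normal `Φ` is `-g`. -/
theorem second_position (h : IsNullLift B Φ g U) {p : Point n} (hp : p ∈ U) (v w : Point n) :
    B (along v (along w Φ) p) (Φ p) = -g p v w := by
  have h1 := h.along_eq_of_eqOn hp (fun q hq => h.orth hq w) v
  rw [along_bilin B (h.diff₀ hp) (h.diff₁ hp w), h.metric p hp] at h1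
  have : along v (fun _ : Point n => (0 : ℝ)) p = 0 := by simp [along]
  rw [h.symm]
  linarith

/-- The Koszul formula: the tangential components of the second derivatives of an isometric map are
the Christoffel symbols of the first kind. -/
theorem koszul (h : IsNullLift B Φ g U) {p : Point n} (hp : p ∈ U) (v w z : Point n) :
    B (along v (along w Φ) p) (along z Φ p) =
      1 / 2 * (along v (fun q => g q w z) p + along w (fun q => g q v z) p
        - along z (fun q => g q v w) p) := by
  have key : ∀ a b c, along a (fun q => g q b c) p =
      B (along a (along b Φ) p) (along c Φ p) + B (along a (along c Φ) p) (along b Φ p) := by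
    intro a b c
    rw [← h.along_eq_of_eqOn hp (fun q hq => h.metric q hq b c) a,
      along_bilin B (h.diff₁ hp b) (h.diff₁ hp c), h.symm (along b Φ p)]
  rw [key, key, key, h.comm₂ hp w v, h.comm₂ hp z v, h.comm₂ hp z w]
  ring

theorem exists_normal [FiniteDimensional ℝ F] (h : IsNullLift B Φ g U) {p : Point n}
    (hp : p ∈ U) :
    ∃ N : F, ∀ h₁ h₂ : F, (∀ v, B h₁ (along v Φ p) = 0) → (∀ v, B h₂ (along v Φ p) = 0) →
      B h₁ h₂ = B h₁ N * B h₂ (Φ p) + B h₁ (Φ p) * B h₂ N :=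
  exists_null_normal B h.symm h.nondeg (by rw [h.finrank]; simp) (fderiv ℝ Φ p).toLinearMap
    (fun v hv => h.nondeg_metric p hp v fun w => by rw [← h.metric p hp]; exact hv w)
    (Φ p) (h.ne_zero p hp) (h.null p hp) (fun v => h.orth hp v)

end IsNullLift

/-! ### The Gauss equation and the Weyl tensor -/

theorem eq_sum_single {n : ℕ} (v : Point n) : v = ∑ i, v i • Pi.single i (1 : ℝ) := by
  ext j
  simp [Finset.sum_apply, Pi.single_apply]

namespace IsNullLift

variable {n : ℕ} {F : Type*} [NormedAddCommGroup F] [NormedSpace ℝ F]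
  {B : F →L[ℝ] F →L[ℝ] ℝ} {Φ : Point n → F} {g : TensorField n} {U : Set (Point n)}

theorem comp_eq (h : IsNullLift B Φ g U) {p : Point n} (hp : p ∈ U) (i j : Fin (n + 1)) :
    comp g p i j = B (along (Pi.single i 1) Φ p) (along (Pi.single j 1) Φ p) := by
  rw [h.metric p hp]
  rfl

theorem det_comp_ne_zero (h : IsNullLift B Φ g U) {p : Point n} (hp : p ∈ U) :
    (comp g p).det ≠ 0 := by
  intro hdet
  obtain ⟨v, hv0, hv⟩ := Matrix.exists_mulVec_eq_zero_iff.2 hdet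
  apply hv0
  have h1 : ∀ i, B (along (Pi.single i 1) Φ p) (along v Φ p) = 0 := by
    intro i
    have h2 := congrFun hv i
    simp only [Matrix.mulVec, dotProduct, h.comp_eq hp] at h2
    conv_lhs => rw [eq_sum_single v]
    simp only [along, map_sum, map_smul, smul_eq_mul] at h2 ⊢
    exact (Finset.sum_congr rfl fun j _ => mul_comm _ _).trans h2
  refine h.nondeg_metric p hp v fun w => ?_
  rw [← h.metric p hp, h.symm]
  rw [eq_sum_single w]
  simp only [along, map_sum, map_smul, sum_apply, smul_apply] at h1 ⊢
  simp [h1]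

theorem comp_symm (h : IsNullLift B Φ g U) {p : Point n} (hp : p ∈ U) (i j : Fin (n + 1)) :
    comp g p i j = comp g p j i := by
  rw [h.comp_eq hp, h.comp_eq hp, h.symm]

theorem isSymm_comp (h : IsNullLift B Φ g U) {p : Point n} (hp : p ∈ U) :
    (comp g p).IsSymm :=
  Matrix.IsSymm.ext fun i j => h.comp_symm hp j i

theorem inv_symm (h : IsNullLift B Φ g U) {p : Point n} (hp : p ∈ U) (i j : Fin (n + 1)) :
    (comp g p)⁻¹ i j = (comp g p)⁻¹ j i := by
  have : ((comp g p)⁻¹).IsSymm := (h.isSymm_comp hp).inv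
  exact this.apply j i

theorem sum_comp_inv (h : IsNullLift B Φ g U) {p : Point n} (hp : p ∈ U) (i j : Fin (n + 1)) :
    ∑ e, comp g p i e * (comp g p)⁻¹ e j = if i = j then 1 else 0 := by
  have := Matrix.mul_nonsing_inv (comp g p) (h.det_comp_ne_zero hp).isUnit
  rw [← Matrix.mul_apply, this, Matrix.one_apply]

theorem differentiableAt_inv (h : IsNullLift B Φ g U) {p : Point n} (hp : p ∈ U)
    (i j : Fin (n + 1)) : DifferentiableAt ℝ (fun q => (comp g q)⁻¹ i j) p := by
  have hc : ∀ i j, DifferentiableAt ℝ (fun q => comp g q i j) p := by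
    intro i j
    have h1 := differentiableAt_of_contDiffOn h.isOpen
      (contDiffOn_bilin B (h.smooth₁ (Pi.single i 1)) (h.smooth₁ (Pi.single j 1))) hp
    exact h1.congr_of_eventuallyEq
      (Filter.eventually_of_mem (h.isOpen.mem_nhds hp) fun q hq => h.comp_eq hq i j)
  have hdet : ∀ M : Point n → Matrix (Fin (n + 1)) (Fin (n + 1)) ℝ,
      (∀ i j, DifferentiableAt ℝ (fun q => M q i j) p) →
      DifferentiableAt ℝ (fun q => (M q).det) p := by
    intro M hM
    simp only [Matrix.det_apply]
    refine DifferentiableAt.fun_sum fun σ _ => ?_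
    exact ((HasFDerivAt.finsetProd fun k _ =>
      (hM (σ k) k).hasFDerivAt).differentiableAt).const_smul _
  simp only [Matrix.inv_def, Ring.inverse_eq_inv', Matrix.smul_apply, smul_eq_mul,
    Matrix.adjugate_apply]
  refine ((hdet _ hc).inv (h.det_comp_ne_zero hp)).mul (hdet _ fun a b => ?_)
  by_cases ha : a = j
  · subst ha
    simp
  · simpa [Matrix.updateRow_ne ha] using hc a b

/-- The Levi-Civita connection is the tangential part of the flat ambient connection. -/
theorem christoffel_eq (h : IsNullLift B Φ g U) {p : Point n} (hp : p ∈ U)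
    (d b c : Fin (n + 1)) :
    christoffel g d b c p = ∑ s, (comp g p)⁻¹ d s *
      B (along (Pi.single b 1) (along (Pi.single c 1) Φ) p) (along (Pi.single s 1) Φ p) := by
  rw [christoffel, Finset.mul_sum]
  refine Finset.sum_congr rfl fun s _ => ?_
  rw [h.koszul hp]
  have hc : ∀ i j k, pd i (fun q => comp g q j k) p =
    along (Pi.single i 1) (fun q => g q (Pi.single j 1) (Pi.single k 1)) p := fun i j k => rfl
  have hs : ∀ i j k, pd i (fun q => comp g q j k) p = pd i (fun q => comp g q k j) p :=
    fun i j k => h.along_eq_of_eqOn hp (fun q hq => h.comp_symm hq j k) _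
  rw [hs b s c, hs c s b, hc, hc, hc]
  ring

theorem differentiableAt_christoffel (h : IsNullLift B Φ g U) {p : Point n} (hp : p ∈ U)
    (d b c : Fin (n + 1)) : DifferentiableAt ℝ (christoffel g d b c) p := by
  have h1 : DifferentiableAt ℝ (fun q => ∑ s, (comp g q)⁻¹ d s *
      B (along (Pi.single b 1) (along (Pi.single c 1) Φ) q) (along (Pi.single s 1) Φ q)) p :=
    DifferentiableAt.fun_sum fun s _ => (h.differentiableAt_inv hp d s).mul
      (differentiableAt_of_contDiffOn h.isOpen (contDiffOn_bilin B (h.smooth₂ _ _)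
        (h.smooth₁ _)) hp)
  exact h1.congr_of_eventuallyEq
    (Filter.eventually_of_mem (h.isOpen.mem_nhds hp) fun q hq => h.christoffel_eq hq d b c)

end IsNullLift

/-- The second fundamental form of a map `Φ` in the coordinates: the normal component
`∂_b ∂_c Φ - Γ^d_{bc} ∂_d Φ`. -/
noncomputable def secondForm {n : ℕ} {F : Type*} [NormedAddCommGroup F] [NormedSpace ℝ F]
    (g : TensorField n) (Φ : Point n → F) (b c : Fin (n + 1)) (p : Point n) : F :=
  along (Pi.single b 1) (along (Pi.single c 1) Φ) p
    - ∑ d, christoffel g d b c p • along (Pi.single d 1) Φ p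

namespace IsNullLift

variable {n : ℕ} {F : Type*} [NormedAddCommGroup F] [NormedSpace ℝ F]
  {B : F →L[ℝ] F →L[ℝ] ℝ} {Φ : Point n → F} {g : TensorField n} {U : Set (Point n)}

theorem sum_comp_christoffel (h : IsNullLift B Φ g U) {p : Point n} (hp : p ∈ U)
    (b c s : Fin (n + 1)) :
    ∑ d, comp g p s d * christoffel g d b c p =
      B (along (Pi.single b 1) (along (Pi.single c 1) Φ) p) (along (Pi.single s 1) Φ p) := by
  simp only [h.christoffel_eq hp, Finset.mul_sum, ← mul_assoc]
  rw [Finset.sum_comm]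
  simp only [← Finset.sum_mul, h.sum_comp_inv hp]
  simp

theorem secondForm_tangent (h : IsNullLift B Φ g U) {p : Point n} (hp : p ∈ U)
    (b c s : Fin (n + 1)) :
    B (secondForm g Φ b c p) (along (Pi.single s 1) Φ p) = 0 := by
  simp only [secondForm, map_sub, map_sum, map_smul, sub_apply, sum_apply, smul_apply,
    smul_eq_mul, ← h.comp_eq hp]
  rw [← h.sum_comp_christoffel hp, sub_eq_zero]
  exact Finset.sum_congr rfl fun d _ => by rw [h.comp_symm hp d s]; ring

theorem secondForm_position (h : IsNullLift B Φ g U) {p : Point n} (hp : p ∈ U)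
    (b c : Fin (n + 1)) : B (secondForm g Φ b c p) (Φ p) = -comp g p b c := by
  simp only [secondForm, map_sub, map_sum, map_smul, sub_apply, sum_apply, smul_apply,
    h.symm _ (Φ p), h.orth hp]
  rw [h.symm, h.second_position hp]
  simp [comp]

theorem secondForm_symm (h : IsNullLift B Φ g U) {p : Point n} (hp : p ∈ U)
    (b c : Fin (n + 1)) : secondForm g Φ b c p = secondForm g Φ c b p := by
  simp only [secondForm, h.christoffel_eq hp, h.comm₂ hp (Pi.single b 1)]

theorem differentiableAt_secondForm (h : IsNullLift B Φ g U) {p : Point n} (hp : p ∈ U)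
    (b c : Fin (n + 1)) : DifferentiableAt ℝ (secondForm g Φ b c) p :=
  (h.diff₂ hp _ _).sub (DifferentiableAt.fun_sum fun d _ =>
    (h.differentiableAt_christoffel hp d b c).smul (h.diff₁ hp _))

/-- The Gauss equation for a null lift, the ambient space being flat. -/
theorem riemann_eq (h : IsNullLift B Φ g U) {p : Point n} (hp : p ∈ U)
    (a b c d : Fin (n + 1)) :
    riemann g a b c d p =
      B (secondForm g Φ a c p) (secondForm g Φ b d p)
        - B (secondForm g Φ b c p) (secondForm g Φ a d p) := by
  -- the `d`-component of `∂_b ∂_a ∂_c Φ`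
  have third : ∀ a b : Fin (n + 1),
      B (along (Pi.single b 1) (along (Pi.single a 1) (along (Pi.single c 1) Φ)) p)
        (along (Pi.single d 1) Φ p) =
      (∑ e, comp g p d e * (pd b (christoffel g e a c) p
        + ∑ s, christoffel g s a c p * christoffel g e s b p))
      - B (secondForm g Φ a c p) (secondForm g Φ b d p) := by
    intro a b
    have hH : B (along (Pi.single b 1) (secondForm g Φ a c) p) (along (Pi.single d 1) Φ p)
        = -B (secondForm g Φ a c p) (secondForm g Φ b d p) := by
      have h1 := h.along_eq_of_eqOn hp (fun q hq => h.secondForm_tangent hq a c d)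
        (Pi.single b 1)
      rw [along_bilin B (h.differentiableAt_secondForm hp a c) (h.diff₁ hp _)] at h1
      have h0 : along (Pi.single b 1) (fun _ : Point n => (0 : ℝ)) p = 0 := by simp [along]
      have h2 : B (secondForm g Φ a c p) (secondForm g Φ b d p) =
          B (secondForm g Φ a c p) (along (Pi.single b 1) (along (Pi.single d 1) Φ) p) := by
        rw [secondForm.eq_1 g Φ b d]
        simp only [map_sub, map_sum, map_smul, h.secondForm_tangent hp]
        simp
      linarith
    have hdec : along (Pi.single a 1) (along (Pi.single c 1) Φ) = fun q =>
        secondForm g Φ a c q + ∑ e, christoffel g e a c q • along (Pi.single e 1) Φ q := by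
      funext q
      simp [secondForm]
    have hdiff : ∀ e ∈ Finset.univ, DifferentiableAt ℝ
        (fun q => christoffel g e a c q • along (Pi.single e 1) Φ q) p := fun e _ =>
      (h.differentiableAt_christoffel hp e a c).smul (h.diff₁ hp _)
    have hsum : along (Pi.single b 1) (along (Pi.single a 1) (along (Pi.single c 1) Φ)) p =
        along (Pi.single b 1) (secondForm g Φ a c) p +
        ∑ e, (pd b (christoffel g e a c) p • along (Pi.single e 1) Φ p
          + christoffel g e a c p • along (Pi.single b 1) (along (Pi.single e 1) Φ) p) := by
      conv_lhs => rw [hdec]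
      have hd := h.differentiableAt_secondForm hp a c
      rw [along_add hd (DifferentiableAt.fun_sum hdiff), along_sum hdiff]
      congr 1
      refine Finset.sum_congr rfl fun e _ => ?_
      rw [along_smul (h.differentiableAt_christoffel hp e a c) (h.diff₁ hp _)]
      rfl
    rw [hsum]
    simp only [map_add, map_sum, map_smul, add_apply, sum_apply, smul_apply, smul_eq_mul, hH,
      ← h.comp_eq hp, mul_add, Finset.sum_add_distrib]
    have h3 : ∀ e, B (along (Pi.single b 1) (along (Pi.single e 1) Φ) p)
        (along (Pi.single d 1) Φ p) = ∑ s, comp g p d s * christoffel g s e b p := by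
      intro e
      rw [h.comm₂ hp, h.sum_comp_christoffel hp]
    simp only [h3, Finset.mul_sum]
    rw [Finset.sum_comm (f := fun e s => christoffel g e a c p *
      (comp g p d s * christoffel g s e b p))]
    have h4 : ∀ x, pd b (christoffel g x a c) p * comp g p x d =
        comp g p d x * pd b (christoffel g x a c) p := fun x => by
      rw [h.comp_symm hp x d, mul_comm]
    have h5 : ∀ y x, christoffel g x a c p * (comp g p d y * christoffel g y x b p) =
        comp g p d y * (christoffel g x a c p * christoffel g y x b p) := fun y x => by ring
    simp only [h4, h5]
    ring
  have h1 := third a b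
  have h2 := third b a
  rw [h.comm₃ hp] at h1
  have h3 : riemann g a b c d p =
      (∑ e, comp g p d e * (pd b (christoffel g e a c) p
        + ∑ s, christoffel g s a c p * christoffel g e s b p))
      - (∑ e, comp g p d e * (pd a (christoffel g e b c) p
        + ∑ s, christoffel g s b c p * christoffel g e s a p)) := by
    rw [riemann, ← Finset.sum_sub_distrib]
    refine Finset.sum_congr rfl fun e _ => ?_
    rw [riemannUp, Finset.sum_sub_distrib]
    ring
  rw [h3]
  linarith

theorem secondForm_tangent' (h : IsNullLift B Φ g U) {p : Point n} (hp : p ∈ U)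
    (b c : Fin (n + 1)) (v : Point n) : B (secondForm g Φ b c p) (along v Φ p) = 0 := by
  have h1 := fun s => h.secondForm_tangent hp b c s
  rw [eq_sum_single v]
  simp only [along, map_sum, map_smul] at h1 ⊢
  simp [h1]

/-- The curvature tensor of a metric with a null lift is, up to sign, the Kulkarni–Nomizu product of
the metric with a symmetric tensor: the second fundamental form of the lift has its values in a
hyperbolic plane, and one of its two null components is `-g`. -/
theorem exists_riemann_eq [FiniteDimensional ℝ F] (h : IsNullLift B Φ g U) {p : Point n}
    (hp : p ∈ U) :
    ∃ P : Fin (n + 1) → Fin (n + 1) → ℝ, (∀ i j, P i j = P j i) ∧ ∀ a b c d,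
      riemann g a b c d p = -(comp g p a c * P b d + comp g p b d * P a c
        - comp g p b c * P a d - comp g p a d * P b c) := by
  obtain ⟨N, hN⟩ := h.exists_normal hp
  refine ⟨fun i j => B (secondForm g Φ i j p) N,
    fun i j => by simp only [h.secondForm_symm hp i j], fun a b c d => ?_⟩
  rw [h.riemann_eq hp,
    hN _ _ (h.secondForm_tangent' hp a c) (h.secondForm_tangent' hp b d),
    hN _ _ (h.secondForm_tangent' hp b c) (h.secondForm_tangent' hp a d)]
  simp only [h.secondForm_position hp]
  ring

theorem riemannUp_eq (h : IsNullLift B Φ g U) {p : Point n} (hp : p ∈ U)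
    (a b c e : Fin (n + 1)) :
    riemannUp g a b c e p = ∑ d, (comp g p)⁻¹ e d * riemann g a b c d p := by
  simp only [riemann, Finset.mul_sum, ← mul_assoc]
  rw [Finset.sum_comm]
  have : ∀ i, ∑ d, (comp g p)⁻¹ e d * comp g p d i = if e = i then 1 else 0 := by
    intro i
    have := Matrix.nonsing_inv_mul (comp g p) (h.det_comp_ne_zero hp).isUnit
    rw [← Matrix.mul_apply, this, Matrix.one_apply]
  simp only [← Finset.sum_mul, this]
  simp

/-- A Kulkarni–Nomizu product of the metric with a symmetric tensor has no trace-free part. -/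
theorem weyl_eq_zero [FiniteDimensional ℝ F] (hn : 3 ≤ n) (h : IsNullLift B Φ g U)
    {p : Point n} (hp : p ∈ U) (a b c d : Fin (n + 1)) : weyl g a b c d p = 0 := by
  obtain ⟨P, hP, hR⟩ := h.exists_riemann_eq hp
  set G := comp g p with hG
  have hsym : ∀ i j, G i j = G j i := h.comp_symm hp
  have hinv : ∀ i j, ∑ e, G⁻¹ i e * G e j = if i = j then 1 else 0 := by
    intro i j
    have := Matrix.nonsing_inv_mul G (h.det_comp_ne_zero hp).isUnit
    rw [← Matrix.mul_apply, this, Matrix.one_apply]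
  have hinv' : ∀ i j, ∑ e, G⁻¹ i e * G j e = if i = j then 1 else 0 := by
    intro i j
    rw [← hinv i j]
    exact Finset.sum_congr rfl fun e _ => by rw [hsym j e]
  have htr : ∑ i, ∑ j, G⁻¹ i j * G i j = (n : ℝ) + 1 := by
    simp only [hinv']
    simp
  set τ := ∑ i, ∑ j, G⁻¹ i j * P i j with hτ
  have hric : ∀ a b, ricci g a b p = -(((n : ℝ) - 1) * P a b) - τ * G a b := by
    intro a b
    simp only [ricci, h.riemannUp_eq hp, hR, ← hG]
    have e : ∀ i j, G⁻¹ i j * -(G a b * P i j + G i j * P a b - G i b * P a j - G a j * P i b) =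
        G⁻¹ i j * G i j * (-P a b) + G⁻¹ i j * P i j * (-G a b)
          + P a j * (G⁻¹ i j * G i b) + G⁻¹ i j * G a j * P i b := fun i j => by ring
    simp only [e, Finset.sum_add_distrib, ← Finset.sum_mul]
    rw [htr, ← hτ, Finset.sum_comm (f := fun i j => P a j * (G⁻¹ i j * G i b))]
    have h1 : ∀ j, ∑ i, P a j * (G⁻¹ i j * G i b) = P a j * if j = b then 1 else 0 := by
      intro j
      rw [← Finset.mul_sum, ← hinv j b]
      congr 1
      exact Finset.sum_congr rfl fun i _ => by rw [h.inv_symm hp i j]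
    simp only [h1, hinv']
    simp
    ring
  have hscal : scalar g p = -(2 * n * τ) := by
    simp only [scalar, hric, ← hG]
    have e : ∀ i j, G⁻¹ i j * (-(((n : ℝ) - 1) * P i j) - τ * G i j) =
        G⁻¹ i j * P i j * (-((n : ℝ) - 1)) + G⁻¹ i j * G i j * (-τ) := fun i j => by ring
    simp only [e, Finset.sum_add_distrib, ← Finset.sum_mul]
    rw [htr, ← hτ]
    ring
  have hn0 : (n : ℝ) ≠ 0 := by positivity
  have hn1 : (n : ℝ) - 1 ≠ 0 := by
    have : (3 : ℝ) ≤ n := by exact_mod_cast hn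
    linarith
  simp only [weyl, hR, hric, hscal, ← hG]
  rw [hP d b, hP d a, hP c b, hP c a, hsym d b, hsym d a, hsym c b, hsym c a]
  field_simp
  ring

end IsNullLift

/-! ### Null lifts of locally conformally flat metrics -/

/-- The quadratic form `-t² + |x|² - s₁ s₂` on `ℝ^{n+3}`, as a bilinear form. -/
noncomputable def ambientForm (n : ℕ) :
    (Point n × ℝ × ℝ) →L[ℝ] (Point n × ℝ × ℝ) →L[ℝ] ℝ :=
  LinearMap.toContinuousBilinearMap <| LinearMap.mk₂ ℝ
    (fun x y => minkowski n 0 x.1 y.1 - 1 / 2 * (x.2.1 * y.2.2 + x.2.2 * y.2.1))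
    (fun x x' y => by
      simp only [minkowski, Prod.fst_add, Prod.snd_add, Pi.add_apply, add_mul,
        Finset.sum_add_distrib]
      ring)
    (fun c x y => by
      simp only [minkowski, Prod.smul_fst, Prod.smul_snd, Pi.smul_apply, smul_eq_mul, mul_assoc,
        ← Finset.mul_sum]
      ring)
    (fun x y y' => by
      simp only [minkowski, Prod.fst_add, Prod.snd_add, Pi.add_apply, mul_add,
        Finset.sum_add_distrib]
      ring)
    (fun c x y => by
      simp only [minkowski, Prod.smul_fst, Prod.smul_snd, Pi.smul_apply, smul_eq_mul,
        mul_left_comm _ c, ← Finset.mul_sum]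
      ring)

theorem ambientForm_apply {n : ℕ} (x y : Point n × ℝ × ℝ) :
    ambientForm n x y =
      minkowski n 0 x.1 y.1 - 1 / 2 * (x.2.1 * y.2.2 + x.2.2 * y.2.1) := rfl

theorem minkowski_symm {n : ℕ} (p v w : Point n) : minkowski n p v w = minkowski n p w v := by
  simp only [minkowski, mul_comm]

theorem minkowski_nondeg {n : ℕ} {p v : Point n} (h : ∀ w, minkowski n p v w = 0) : v = 0 := by
  have h1 := h fun i => if i = 0 then -v i else v i
  simp only [minkowski, Fin.succ_ne_zero, if_false, if_true] at h1
  have h2 : v 0 ^ 2 + ∑ i : Fin n, v i.succ ^ 2 = 0 := by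
    rw [← h1]
    simp only [pow_two]
    ring
  have h3 : 0 ≤ ∑ i : Fin n, v i.succ ^ 2 := Finset.sum_nonneg fun i _ => sq_nonneg _
  have h4 : v 0 = 0 := by nlinarith [sq_nonneg (v 0)]
  have h5 : ∑ i : Fin n, v i.succ ^ 2 = 0 := by nlinarith [sq_nonneg (v 0)]
  rw [Finset.sum_eq_zero_iff_of_nonneg fun i _ => sq_nonneg _] at h5
  ext i
  refine Fin.cases h4 (fun j => ?_) i
  simpa using h5 j (Finset.mem_univ j)

theorem ambientForm_symm {n : ℕ} (x y : Point n × ℝ × ℝ) :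
    ambientForm n x y = ambientForm n y x := by
  rw [ambientForm_apply, ambientForm_apply, minkowski_symm]
  ring

theorem ambientForm_nondeg {n : ℕ} (x : Point n × ℝ × ℝ)
    (h : ∀ y, ambientForm n x y = 0) : x = 0 := by
  obtain ⟨v, a, b⟩ := x
  have h1 := h (0, 0, 1)
  have h2 := h (0, 1, 0)
  simp [ambientForm_apply, minkowski] at h1 h2
  have h3 : v = 0 := minkowski_nondeg (p := 0) fun w => by
    simpa [ambientForm_apply] using h (w, 0, 0)
  simp [h1, h2, h3]

theorem IsDiffeo.symm {n : ℕ} {φ : OpenPartialHomeomorph (Point n) (Point n)}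
    (hφ : IsDiffeo φ) : IsDiffeo φ.symm :=
  ⟨hφ.2, by simpa using hφ.1⟩

theorem IsDiffeo.fderiv_symm_apply {n : ℕ} {φ : OpenPartialHomeomorph (Point n) (Point n)}
    (hφ : IsDiffeo φ) {p : Point n} (hp : p ∈ φ.source) (v : Point n) :
    fderiv ℝ φ.symm (φ p) (fderiv ℝ φ p v) = v := by
  have h1 := differentiableAt_of_contDiffOn φ.open_source hφ.1 hp
  have h2 := differentiableAt_of_contDiffOn φ.open_target hφ.2 (φ.map_source hp)
  have h3 : HasFDerivAt (fun q => φ.symm (φ q)) ((fderiv ℝ φ.symm (φ p)).comp (fderiv ℝ φ p)) p :=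
    h2.hasFDerivAt.comp p h1.hasFDerivAt
  have h4 : HasFDerivAt (fun q => φ.symm (φ q)) (ContinuousLinearMap.id ℝ (Point n)) p :=
    (hasFDerivAt_id p).congr_of_eventuallyEq
      (Filter.eventually_of_mem (φ.open_source.mem_nhds hp) fun q hq => φ.left_inv hq)
  have h5 := h3.unique h4
  exact congrArg (fun l : Point n →L[ℝ] Point n => l v) h5

/-- A conformal factor `Ω` and coordinates `φ` give the null lift `√Ω (φ, 1, ⟨φ, φ⟩)`: rescaling a
section of the null cone rescales the induced metric by the square of the factor. -/
theorem exists_isNullLift {n : ℕ} {g : TensorField n} {V : Set (Point n)}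
    (hg : LocallyConformallyFlat g V) {p : Point n} (hp : p ∈ V) :
    ∃ (U : Set (Point n)) (Φ : Point n → Point n × ℝ × ℝ), p ∈ U ∧ U ⊆ V ∧
      IsNullLift (ambientForm n) Φ g U := by
  obtain ⟨φ, Ω, hφ, hpφ, hsub, hΩ, hgφ⟩ := hg p hp
  have hs : ContDiffOn ℝ ∞ (fun q => √(Ω q)) φ.source :=
    hΩ.sqrt fun q hq => (hgφ q hq).1.ne'
  -- the section of the null cone over Minkowski space
  let X : Point n → Point n × ℝ × ℝ := fun y => (y, 1, minkowski n 0 y y)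
  have hmink : ContDiff ℝ ∞ fun y : Point n => minkowski n 0 y y := by
    unfold minkowski
    fun_prop
  have hX : ContDiff ℝ ∞ X := contDiff_id.prodMk (contDiff_const.prodMk hmink)
  have hXφ : ContDiffOn ℝ ∞ (fun q => X (φ q)) φ.source := hX.comp_contDiffOn hφ.1
  have hXX : ∀ y, ambientForm n (X y) (X y) = 0 := fun y => by
    simp only [ambientForm_apply, X]
    ring
  have hX' : ∀ y v, HasFDerivAt X (fderiv ℝ X y) y ∧ (fderiv ℝ X y v).1 = v ∧
      (fderiv ℝ X y v).2.1 = 0 := by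
    intro y v
    have h1 : HasFDerivAt X _ y := (hasFDerivAt_id y).prodMk ((hasFDerivAt_const (1 : ℝ) y).prodMk
      ((hmink.differentiable (by simp)) y).hasFDerivAt)
    refine ⟨h1.differentiableAt.hasFDerivAt, ?_, ?_⟩ <;> rw [h1.fderiv] <;> simp
  have hΦ : ∀ q ∈ φ.source, ∀ v, along v (fun q => √(Ω q) • X (φ q)) q =
      along v (fun q => √(Ω q)) q • X (φ q) + √(Ω q) • fderiv ℝ X (φ q) (fderiv ℝ φ q v) := by
    intro q hq v
    rw [along_smul (differentiableAt_of_contDiffOn φ.open_source hs hq)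
      (differentiableAt_of_contDiffOn φ.open_source hXφ hq)]
    congr 2
    have h1 : HasFDerivAt (fun q => X (φ q)) ((fderiv ℝ X (φ q)).comp (fderiv ℝ φ q)) q :=
      (hX' (φ q) 0).1.comp q
        (differentiableAt_of_contDiffOn φ.open_source hφ.1 hq).hasFDerivAt
    simp [along, h1.fderiv]
  have hXd : ∀ y v, ambientForm n (X y) (fderiv ℝ X y v) = 0 := by
    intro y v
    have hd : DifferentiableAt ℝ X y := (hX' y 0).1.differentiableAt
    have h1 := along_bilin (ambientForm n) hd hd v
    rw [show (fun q => ambientForm n (X q) (X q)) = fun _ => (0 : ℝ) from funext hXX] at h1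
    have h2 : along v (fun _ : Point n => (0 : ℝ)) y = 0 := by simp [along]
    rw [h2, ambientForm_symm (along v X y)] at h1
    change 0 = ambientForm n (X y) (fderiv ℝ X y v) + ambientForm n (X y) (fderiv ℝ X y v) at h1
    linarith
  refine ⟨φ.source, fun q => √(Ω q) • X (φ q), hpφ, hsub,
    { isOpen := φ.open_source
      symm := ambientForm_symm
      nondeg := ambientForm_nondeg
      finrank := by simp
      smooth := hs.smul hXφ
      null := fun q _ => by simp [hXX]
      ne_zero := fun q hq => ?_
      metric := fun q hq v w => ?_
      nondeg_metric := fun q hq v hv => ?_ }⟩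
  · have : √(Ω q) ≠ 0 := (Real.sqrt_pos.2 (hgφ q hq).1).ne'
    simp [X, this]
  · have h1 : ambientForm n (fderiv ℝ X (φ q) (fderiv ℝ φ q v))
        (fderiv ℝ X (φ q) (fderiv ℝ φ q w)) =
        minkowski n 0 (fderiv ℝ φ q v) (fderiv ℝ φ q w) := by
      rw [ambientForm_apply, (hX' _ _).2.1, (hX' _ _).2.1, (hX' _ _).2.2, (hX' _ _).2.2]
      ring
    rw [hΦ q hq, hΦ q hq, (hgφ q hq).2]
    simp only [map_add, map_smul, add_apply, smul_apply, smul_eq_mul, hXX, hXd, h1,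
      ambientForm_symm _ (X (φ q))]
    have h2 := Real.mul_self_sqrt (hgφ q hq).1.le
    simp only [pullback]
    change _ = Ω q * minkowski n 0 _ _
    linear_combination (minkowski n 0 (fderiv ℝ φ q v) (fderiv ℝ φ q w)) * h2
  -- nondegeneracy is that of the Minkowski metric, since the differential of `φ` is invertible
  · have h1 : fderiv ℝ φ q v = 0 := minkowski_nondeg (p := φ q) fun w => by
      have h2 := hv (fderiv ℝ φ.symm (φ q) w)
      rw [(hgφ q hq).2] at h2
      have h3 := hφ.symm.fderiv_symm_apply (p := φ q) (φ.map_source hq) w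
      rw [φ.symm_symm, φ.left_inv hq] at h3
      simp only [pullback, h3] at h2
      exact (mul_eq_zero.1 h2).resolve_left (hgφ q hq).1.ne'
    have h2 := hφ.fderiv_symm_apply hq v
    rw [h1, map_zero] at h2
    exact h2.symm

theorem weyl_eq_zero_of_locallyConformallyFlat {n : ℕ} (hn : 3 ≤ n) {g : TensorField n}
    {V : Set (Point n)} (hg : LocallyConformallyFlat g V) {p : Point n} (hp : p ∈ V)
    (a b c d : Fin (n + 1)) : weyl g a b c d p = 0 := by
  obtain ⟨U, Φ, hpU, -, hΦ⟩ := exists_isNullLift hg hp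
  exact hΦ.weyl_eq_zero hn hpU a b c d

/-! ### Local diffeomorphisms -/

/-- Local conformal flatness is transported by isometries. -/
theorem LocallyConformallyFlat.of_isometry {n : ℕ} {g₁ g₂ : TensorField n}
    {U : Set (Point n)} (hg : LocallyConformallyFlat g₁ U)
    {φ : OpenPartialHomeomorph (Point n) (Point n)} (hφ : IsDiffeo φ) (hsub : φ.source ⊆ U)
    (hiso : ∀ p ∈ φ.source, pullback φ g₂ p = g₁ p) :
    LocallyConformallyFlat g₂ φ.target := by
  intro q hq
  obtain ⟨ψ, Ω, hψ, hqψ, -, hΩ, hgψ⟩ := hg (φ.symm q) (hsub (φ.map_target hq))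
  have hsrc : (φ.symm.trans ψ).source = φ.target ∩ φ.symm ⁻¹' ψ.source := by
    simp
  have htgt : (φ.symm.trans ψ).target = ψ.target ∩ ψ.symm ⁻¹' φ.source := by
    simp
  refine ⟨φ.symm.trans ψ, Ω ∘ φ.symm, ⟨?_, ?_⟩, ?_, ?_, ?_, ?_⟩
  · rw [hsrc]
    exact hψ.1.comp (hφ.2.mono Set.inter_subset_left) fun x hx => hx.2
  · rw [htgt]
    exact hφ.1.comp (hψ.2.mono Set.inter_subset_left) fun x hx => hx.2
  · rw [hsrc]
    exact ⟨hq, hqψ⟩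
  · rw [hsrc]
    exact Set.inter_subset_left
  · rw [hsrc]
    exact hΩ.comp (hφ.2.mono Set.inter_subset_left) fun x hx => hx.2
  · rw [hsrc]
    rintro x ⟨hx, hxψ⟩
    refine ⟨(hgψ _ hxψ).1, fun v w => ?_⟩
    have hback : ∀ v, fderiv ℝ φ (φ.symm x) (fderiv ℝ φ.symm x v) = v := by
      intro v
      have := hφ.symm.fderiv_symm_apply (p := x) hx v
      rwa [φ.symm_symm] at this
    have h1 := congrFun (congrFun (hiso _ (φ.map_target hx)) (fderiv ℝ φ.symm x v))
      (fderiv ℝ φ.symm x w)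
    simp only [pullback, hback, φ.right_inv hx] at h1
    have h2 : ∀ v, fderiv ℝ (φ.symm.trans ψ) x v =
        fderiv ℝ ψ (φ.symm x) (fderiv ℝ φ.symm x v) := by
      intro v
      have h3 : HasFDerivAt (fun q => ψ (φ.symm q))
          ((fderiv ℝ ψ (φ.symm x)).comp (fderiv ℝ φ.symm x)) x :=
        (differentiableAt_of_contDiffOn ψ.open_source hψ.1 hxψ).hasFDerivAt.comp x
          (differentiableAt_of_contDiffOn φ.open_target hφ.2 hx).hasFDerivAt
      exact congrArg (fun l : Point n →L[ℝ] Point n => l v) h3.fderiv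
    rw [h1, (hgψ _ hxψ).2]
    simp only [pullback, h2, Function.comp_apply]
    rfl

/-- The inverse function theorem: a smooth map with injective differential restricts to a
diffeomorphism near each point. -/
theorem exists_isDiffeo {n : ℕ} {f : Point n → Point n} {W : Set (Point n)} (hW : IsOpen W)
    (hf : ContDiffOn ℝ ∞ f W) (hinj : ∀ q ∈ W, ∀ v, fderiv ℝ f q v = 0 → v = 0)
    {p : Point n} (hp : p ∈ W) :
    ∃ φ : OpenPartialHomeomorph (Point n) (Point n), IsDiffeo φ ∧ p ∈ φ.source ∧
      φ.source ⊆ W ∧ (φ : Point n → Point n) = f := by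
  have hequiv : ∀ q ∈ W, ∃ e : Point n ≃L[ℝ] Point n,
      HasFDerivAt f (e : Point n →L[ℝ] Point n) q := by
    intro q hq
    have hi : Function.Injective (fderiv ℝ f q).toLinearMap := by
      rw [← LinearMap.ker_eq_bot, LinearMap.ker_eq_bot']
      exact hinj q hq
    refine ⟨(LinearEquiv.ofInjectiveEndo _ hi).toContinuousLinearEquiv, ?_⟩
    exact (differentiableAt_of_contDiffOn hW hf hq).hasFDerivAt.congr_fderiv (by ext v; rfl)
  have hat : ∀ q ∈ W, ContDiffAt ℝ ∞ f q := fun q hq => hf.contDiffAt (hW.mem_nhds hq)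
  obtain ⟨e, he⟩ := hequiv p hp
  let φ := ((hat p hp).toOpenPartialHomeomorph f he (by simp)).restrOpen W hW
  have hsrc : φ.source ⊆ W := Set.inter_subset_right
  have hcoe : (φ : Point n → Point n) = f := rfl
  refine ⟨φ, ⟨hf.mono hsrc, fun y hy => ?_⟩,
    ⟨(hat p hp).mem_toOpenPartialHomeomorph_source he (by simp), hp⟩, hsrc, hcoe⟩
  have hy' : φ.symm y ∈ W := hsrc (φ.map_target hy)
  obtain ⟨e', he'⟩ := hequiv _ hy'
  exact (φ.contDiffAt_symm hy he' (hat _ hy')).contDiffWithinAt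

/-! ### The radial coordinate -/

/-- The square `r² = |x|²` of the radial coordinate. -/
def radiusSq {n : ℕ} (p : Point n) : ℝ := ∑ i : Fin n, p i.succ ^ 2

/-- The spatial inner product `∑ vⁱ wⁱ`. -/
def spatial {n : ℕ} (v w : Point n) : ℝ := ∑ i : Fin n, v i.succ * w i.succ

theorem radiusSq_nonneg {n : ℕ} (p : Point n) : 0 ≤ radiusSq p :=
  Finset.sum_nonneg fun _ _ => sq_nonneg _

theorem radius_eq {n : ℕ} (p : Point n) : radius p = √(radiusSq p) := rfl

theorem radius_sq {n : ℕ} (p : Point n) : radius p ^ 2 = radiusSq p :=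
  Real.sq_sqrt (radiusSq_nonneg p)

theorem radius_pos_iff {n : ℕ} (p : Point n) : 0 < radius p ↔ 0 < radiusSq p := Real.sqrt_pos

theorem dr_mul_dr {n : ℕ} (p v w : Point n) :
    dr p v * dr p w = spatial p v * spatial p w / radiusSq p := by
  rw [dr, dr, div_mul_div_comm, ← pow_two, radius_sq]
  rfl

theorem sphereMetric_eq {n : ℕ} (p v w : Point n) :
    sphereMetric p v w =
      (spatial v w - spatial p v * spatial p w / radiusSq p) / radiusSq p := by
  rw [sphereMetric, dr_mul_dr, radius_sq]
  rfl

@[fun_prop]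
theorem contDiff_radiusSq {n : ℕ} : ContDiff ℝ ∞ (radiusSq : Point n → ℝ) := by
  unfold radiusSq
  fun_prop

theorem radius_lt_one_div_sqrt_iff {n : ℕ} (p : Point n) (κ : ℝ) :
    (0 < κ → radius p < 1 / √κ) ↔ 0 < 1 - κ * radiusSq p := by
  rcases le_or_gt κ 0 with hκ | hκ
  · have h1 : κ * radiusSq p ≤ 0 := mul_nonpos_of_nonpos_of_nonneg hκ (radiusSq_nonneg p)
    exact ⟨fun _ => by linarith, fun _ h => absurd h hκ.not_gt⟩
  · have h1 : radius p < 1 / √κ ↔ radiusSq p < 1 / κ := by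
      rw [radius_eq, ← Real.sqrt_one, ← Real.sqrt_div zero_le_one, Real.sqrt_one]
      exact Real.sqrt_lt_sqrt_iff (radiusSq_nonneg p)
    rw [lt_div_iff₀ hκ] at h1
    exact ⟨fun h => by linarith [h1.1 (h hκ)], fun h _ => h1.2 (by linarith)⟩

theorem mem_conformalDomain_iff {n : ℕ} {I : Set ℝ} {k : ℝ → ℝ} {p : Point n} :
    p ∈ conformalDomain n I k ↔
      p 0 ∈ I ∧ 0 < radiusSq p ∧ 0 < 1 + k (p 0) * radiusSq p := by
  have h := radius_lt_one_div_sqrt_iff p (-k (p 0))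
  rw [neg_mul, sub_neg_eq_add, neg_pos] at h
  rw [← h, ← radius_pos_iff]
  rfl

/-! ### The conformal metric is locally conformally flat -/

/-- Local solutions of the linear system `y' = -β z`, `z' = α y`. -/
theorem exists_linear_solution {I : Set ℝ} (hI : IsOpen I) {α β : ℝ → ℝ}
    (hα : ContDiffOn ℝ ∞ α I) (hβ : ContDiffOn ℝ ∞ β I) {t₀ : ℝ} (ht₀ : t₀ ∈ I) (y₀ z₀ : ℝ) :
    ∃ (δ : ℝ) (y z : ℝ → ℝ), 0 < δ ∧ Set.Ioo (t₀ - δ) (t₀ + δ) ⊆ I ∧ y t₀ = y₀ ∧ z t₀ = z₀ ∧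
      ContDiffOn ℝ ∞ y (Set.Ioo (t₀ - δ) (t₀ + δ)) ∧
      ContDiffOn ℝ ∞ z (Set.Ioo (t₀ - δ) (t₀ + δ)) ∧
      ∀ t ∈ Set.Ioo (t₀ - δ) (t₀ + δ),
        HasDerivAt y (-(β t * z t)) t ∧ HasDerivAt z (α t * y t) t := by
  -- the autonomous system with the time as an additional unknown
  let f : ℝ × ℝ × ℝ → ℝ × ℝ × ℝ := fun x => (1, -(β x.1 * x.2.2), α x.1 * x.2.1)
  have hf : ContDiffAt ℝ ∞ f (t₀, y₀, z₀) := by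
    have ha : ContDiffAt ℝ ∞ (fun x : ℝ × ℝ × ℝ => α x.1) (t₀, y₀, z₀) :=
      ContDiffAt.comp (t₀, y₀, z₀) (hα.contDiffAt (hI.mem_nhds ht₀)) contDiffAt_fst
    have hb : ContDiffAt ℝ ∞ (fun x : ℝ × ℝ × ℝ => β x.1) (t₀, y₀, z₀) :=
      ContDiffAt.comp (t₀, y₀, z₀) (hβ.contDiffAt (hI.mem_nhds ht₀)) contDiffAt_fst
    exact contDiffAt_const.prodMk
      ((hb.mul (by fun_prop)).neg.prodMk (ha.mul (by fun_prop)))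
  obtain ⟨γ, hγ0, ε, hε, hγ⟩ := (hf.of_le (by simp :
    (1 : WithTop ℕ∞) ≤ ∞)).exists_forall_mem_closedBall_exists_eq_forall_mem_Ioo_hasDerivAt₀ t₀
  obtain ⟨ε', hε', hball⟩ := Metric.isOpen_iff.1 hI t₀ ht₀
  rw [Real.ball_eq_Ioo] at hball
  have hδ : 0 < min ε ε' := lt_min hε hε'
  set δ := min ε ε' with hδdef
  have hsub : Set.Ioo (t₀ - δ) (t₀ + δ) ⊆ Set.Ioo (t₀ - ε) (t₀ + ε) :=
    Set.Ioo_subset_Ioo (by linarith [min_le_left ε ε']) (by linarith [min_le_left ε ε'])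
  have hsub' : Set.Ioo (t₀ - δ) (t₀ + δ) ⊆ I := (Set.Ioo_subset_Ioo
    (by linarith [min_le_right ε ε']) (by linarith [min_le_right ε ε'])).trans hball
  have h1 : ∀ t ∈ Set.Ioo (t₀ - δ) (t₀ + δ), HasDerivAt (fun s => (γ s).1) 1 t := fun t ht =>
    (hγ t (hsub ht)).fst
  have htime : ∀ t ∈ Set.Ioo (t₀ - δ) (t₀ + δ), (γ t).1 = t := by
    intro t ht
    have h2 : ∀ s ∈ Set.Ioo (t₀ - δ) (t₀ + δ), HasDerivAt (fun s => (γ s).1 - s) 0 s :=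
      fun s hs => by
        have := (h1 s hs).fun_sub (hasDerivAt_id' s)
        simpa using this
    have h3 := isOpen_Ioo.is_const_of_deriv_eq_zero isPreconnected_Ioo
      (fun s hs => (h2 s hs).differentiableAt.differentiableWithinAt)
      (fun s hs => (h2 s hs).deriv) ht
      (show t₀ ∈ Set.Ioo (t₀ - δ) (t₀ + δ) from ⟨by linarith, by linarith⟩)
    have h4 : (γ t).1 - t = (γ t₀).1 - t₀ := h3
    rw [hγ0] at h4
    simpa [sub_eq_zero] using h4
  have hy : ∀ t ∈ Set.Ioo (t₀ - δ) (t₀ + δ), HasDerivAt (fun s => (γ s).2.1)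
      (-(β t * (γ t).2.2)) t := fun t ht => by
    have := (hγ t (hsub ht)).hasFDerivAt.snd.fst.hasDerivAt
    simpa [f, htime t ht] using this
  have hz : ∀ t ∈ Set.Ioo (t₀ - δ) (t₀ + δ), HasDerivAt (fun s => (γ s).2.2)
      (α t * (γ t).2.1) t := fun t ht => by
    have := (hγ t (hsub ht)).hasFDerivAt.snd.snd.hasDerivAt
    simpa [f, htime t ht] using this
  have hsmooth : ∀ m : ℕ,
      ContDiffOn ℝ m (fun s => (γ s).2.1) (Set.Ioo (t₀ - δ) (t₀ + δ)) ∧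
      ContDiffOn ℝ m (fun s => (γ s).2.2) (Set.Ioo (t₀ - δ) (t₀ + δ)) := by
    intro m
    induction m with
    | zero =>
      simp only [Nat.cast_zero, contDiffOn_zero]
      exact ⟨fun t ht => (hy t ht).continuousAt.continuousWithinAt,
        fun t ht => (hz t ht).continuousAt.continuousWithinAt⟩
    | succ m ih =>
      have ha : ContDiffOn ℝ m α (Set.Ioo (t₀ - δ) (t₀ + δ)) :=
        (contDiffOn_infty.1 hα m).mono hsub'
      have hb : ContDiffOn ℝ m β (Set.Ioo (t₀ - δ) (t₀ + δ)) :=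
        (contDiffOn_infty.1 hβ m).mono hsub'
      push_cast
      constructor <;> rw [contDiffOn_succ_iff_deriv_of_isOpen isOpen_Ioo]
      · exact ⟨fun t ht => (hy t ht).differentiableAt.differentiableWithinAt, by simp,
          (hb.mul ih.2).neg.congr fun t ht => (hy t ht).deriv⟩
      · exact ⟨fun t ht => (hz t ht).differentiableAt.differentiableWithinAt, by simp,
          (ha.mul ih.1).congr fun t ht => (hz t ht).deriv⟩
  exact ⟨δ, fun s => (γ s).2.1, fun s => (γ s).2.2, hδ, hsub', by simp [hγ0], by simp [hγ0],
    contDiffOn_infty.2 fun m => (hsmooth m).1, contDiffOn_infty.2 fun m => (hsmooth m).2,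
    fun t ht => ⟨hy t ht, hz t ht⟩⟩

theorem conformal_eq {n : ℕ} (a k : ℝ → ℝ) {p : Point n} (hp : 0 < radiusSq p)
    (v w : Point n) :
    conformal n a k p v w = -(v 0 * w 0) +
      4 * a (p 0) ^ 2 / (1 + k (p 0) * radiusSq p) ^ 2 * spatial v w := by
  rw [conformal, dr_mul_dr, sphereMetric_eq, radius_sq]
  congr 2
  field_simp
  ring

theorem hasDerivAt_line_radiusSq {n : ℕ} (q v : Point n) :
    HasDerivAt (fun s : ℝ => radiusSq (q + s • v)) (2 * spatial q v) 0 := by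
  have h : ∀ i ∈ (Finset.univ : Finset (Fin n)),
      HasDerivAt (fun s : ℝ => (q i.succ + s * v i.succ) ^ 2) (2 * (q i.succ * v i.succ)) 0 := by
    intro i _
    have h1 : HasDerivAt (fun s : ℝ => q i.succ + s * v i.succ) (v i.succ) 0 := by
      simpa using ((hasDerivAt_id (0 : ℝ)).mul_const (v i.succ)).const_add (q i.succ)
    exact (h1.fun_pow 2).congr_deriv (by simp; ring)
  have h2 := HasDerivAt.fun_sum h
  rw [← Finset.mul_sum] at h2
  exact h2

theorem hasDerivAt_line_time {n : ℕ} {f : ℝ → ℝ} {f' : ℝ} {q : Point n}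
    (hf : HasDerivAt f f' (q 0)) (v : Point n) :
    HasDerivAt (fun s : ℝ => f ((q + s • v) 0)) (f' * v 0) 0 := by
  have h1 : HasDerivAt (fun s : ℝ => q 0 + s * v 0) (v 0) 0 := by
    simpa using ((hasDerivAt_id (0 : ℝ)).mul_const (v 0)).const_add (q 0)
  have h2 : HasDerivAt f f' (q 0 + (0 : ℝ) * v 0) := by simpa using hf
  exact h2.comp (0 : ℝ) h1

theorem fderiv_apply_eq_along {n : ℕ} {f : Point n → Point n} {q : Point n}
    (hf : DifferentiableAt ℝ f q) (v : Point n) (j : Fin (n + 1)) :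
    fderiv ℝ f q v j = along v (fun x => f x j) q := by
  have h := (hasFDerivAt_pi'.1 hf.hasFDerivAt j).fderiv
  simp only [along]
  rw [h]
  rfl

/-- The coordinates in which the conformal metric is conformal to the Minkowski metric. On the
light-cone coordinates `τ ± R` of Minkowski space, the map `(t, r) ↦ (τ, R)` is the action
`s ↦ (A s + B) / (C s + D)` of a `t`-dependent Möbius transformation on `± r`. -/
noncomputable def mobiusMap (n : ℕ) (A B C D : ℝ → ℝ) (q : Point n) : Point n :=
  Fin.cons ((B (q 0) * D (q 0) - A (q 0) * C (q 0) * radiusSq q) /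
      (D (q 0) ^ 2 - C (q 0) ^ 2 * radiusSq q))
    fun i => q i.succ / (D (q 0) ^ 2 - C (q 0) ^ 2 * radiusSq q)

/-- If the time derivative of the Möbius transformations is their differential applied to the vector
field `(α + β s²) ∂_s`, which is what the four differential equations say, then the pullback of the
Minkowski metric is conformal to `-(α + β r²)² dt² + |dx|²`. -/
theorem pullback_mobiusMap {n : ℕ} {A B C D : ℝ → ℝ} {q : Point n} {α β : ℝ}
    (hA : HasDerivAt A (-(β * B (q 0))) (q 0)) (hB : HasDerivAt B (α * A (q 0)) (q 0))
    (hC : HasDerivAt C (-(β * D (q 0))) (q 0)) (hD : HasDerivAt D (α * C (q 0)) (q 0))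
    (hdet : A (q 0) * D (q 0) - B (q 0) * C (q 0) = 1)
    (hm : D (q 0) ^ 2 - C (q 0) ^ 2 * radiusSq q ≠ 0)
    (hdiff : DifferentiableAt ℝ (mobiusMap n A B C D) q) (v w : Point n) :
    (D (q 0) ^ 2 - C (q 0) ^ 2 * radiusSq q) ^ 2 *
      pullback (mobiusMap n A B C D) (minkowski n) q v w =
      -((α + β * radiusSq q) ^ 2 * (v 0 * w 0)) + spatial v w := by
  have hdiff' : ∀ j, DifferentiableAt ℝ (fun x => mobiusMap n A B C D x j) q :=
    fun j => differentiableAt_pi.1 hdiff j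
  have hm' : ∀ v : Point n, D ((q + (0 : ℝ) • v) 0) ^ 2
      - C ((q + (0 : ℝ) • v) 0) ^ 2 * radiusSq (q + (0 : ℝ) • v) ≠ 0 := fun v => by simpa using hm
  -- the derivative of the denominator `m = D² - C² r²`
  have dm : ∀ v : Point n, HasDerivAt
      (fun s : ℝ => D ((q + s • v) 0) ^ 2 - C ((q + s • v) 0) ^ 2 * radiusSq (q + s • v))
      (2 * C (q 0) * D (q 0) * (α + β * radiusSq q) * v 0
        - 2 * C (q 0) ^ 2 * spatial q v) 0 := by
    intro v
    refine (((hasDerivAt_line_time hD v).fun_pow 2).fun_sub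
      (((hasDerivAt_line_time hC v).fun_pow 2).fun_mul
        (hasDerivAt_line_radiusSq q v))).congr_deriv ?_
    simp
    ring
  have dtime : ∀ v, fderiv ℝ (mobiusMap n A B C D) q v 0 =
      ((α + β * radiusSq q) * (D (q 0) ^ 2 + C (q 0) ^ 2 * radiusSq q) * v 0
        - 2 * C (q 0) * D (q 0) * spatial q v) /
        (D (q 0) ^ 2 - C (q 0) ^ 2 * radiusSq q) ^ 2 := by
    intro v
    rw [fderiv_apply_eq_along hdiff]
    refine along_eq_of_line (hdiff' 0) ((((hasDerivAt_line_time hB v).fun_mul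
      (hasDerivAt_line_time hD v)).fun_sub (((hasDerivAt_line_time hA v).fun_mul
      (hasDerivAt_line_time hC v)).fun_mul (hasDerivAt_line_radiusSq q v))).fun_div (dm v)
      (hm' v) |>.congr_deriv ?_) (Filter.Eventually.of_forall fun s => rfl)
    simp only [zero_smul, add_zero]
    congr 1
    linear_combination ((α + β * radiusSq q) * (D (q 0) ^ 2 + C (q 0) ^ 2 * radiusSq q) * v 0
      - 2 * C (q 0) * D (q 0) * spatial q v) * hdet
  have dspace : ∀ v (i : Fin n), fderiv ℝ (mobiusMap n A B C D) q v i.succ =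
      (v i.succ * (D (q 0) ^ 2 - C (q 0) ^ 2 * radiusSq q) - q i.succ *
        (2 * C (q 0) * D (q 0) * (α + β * radiusSq q) * v 0 - 2 * C (q 0) ^ 2 * spatial q v)) /
        (D (q 0) ^ 2 - C (q 0) ^ 2 * radiusSq q) ^ 2 := by
    intro v i
    rw [fderiv_apply_eq_along hdiff]
    have h1 : HasDerivAt (fun s : ℝ => (q + s • v) i.succ) (v i.succ) 0 := by
      simpa using ((hasDerivAt_id (0 : ℝ)).mul_const (v i.succ)).const_add (q i.succ)
    refine along_eq_of_line (hdiff' i.succ) (h1.fun_div (dm v) (hm' v) |>.congr_deriv ?_)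
      (Filter.Eventually.of_forall fun s => rfl)
    simp only [zero_smul, add_zero]
  have hsum : ∀ x y m : ℝ, ∑ i : Fin n, (v i.succ * m - q i.succ * x) / m ^ 2 *
      ((w i.succ * m - q i.succ * y) / m ^ 2) =
      (m ^ 2 * spatial v w - m * y * spatial q v - m * x * spatial q w
        + x * y * radiusSq q) / m ^ 4 := by
    intro x y m
    simp only [spatial, radiusSq, Finset.mul_sum, ← Finset.sum_add_distrib,
      ← Finset.sum_sub_distrib, Finset.sum_div]
    exact Finset.sum_congr rfl fun i _ => by
      rw [div_mul_div_comm]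
      congr 1 <;> ring
  simp only [pullback, minkowski, dtime, dspace]
  rw [hsum]
  field_simp
  ring

/-- The conformal metric is `4a²/(1 + k r²)²` times `-(α + β r²)² dt² + |dx|²` for `α = 1/(2a)` and
`β = k/(2a)`, so `mobiusMap` provides the coordinates; it starts from the identity transformation at
the time of the given point, where its denominator therefore does not vanish. -/
theorem locallyConformallyFlat_conformal (n : ℕ) {I : Set ℝ} {a k : ℝ → ℝ}
    (h : IsData I a k) :
    LocallyConformallyFlat (conformal n a k) (conformalDomain n I k) := by
  intro p hp
  have hp' := mem_conformalDomain_iff.1 hp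
  have hα : ContDiffOn ℝ ∞ (fun t => 1 / (2 * a t)) I :=
    contDiffOn_const.div (contDiffOn_const.mul h.smooth_a) fun t ht => by
      have := h.pos_a t ht
      positivity
  have hβ : ContDiffOn ℝ ∞ (fun t => k t / (2 * a t)) I :=
    h.smooth_k.div (contDiffOn_const.mul h.smooth_a) fun t ht => by
      have := h.pos_a t ht
      positivity
  obtain ⟨δ₁, A, B, hδ₁, hI₁, hA0, hB0, hA, hB, hAB⟩ :=
    exists_linear_solution h.isOpen hα hβ hp'.1 1 0
  obtain ⟨δ₂, C, D, hδ₂, hI₂, hC0, hD0, hC, hD, hCD⟩ :=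
    exists_linear_solution h.isOpen hα hβ hp'.1 0 1
  set δ := min δ₁ δ₂ with hδ
  have hδ0 : 0 < δ := lt_min hδ₁ hδ₂
  set J := Set.Ioo (p 0 - δ) (p 0 + δ) with hJ
  have hJ₁ : J ⊆ Set.Ioo (p 0 - δ₁) (p 0 + δ₁) :=
    Set.Ioo_subset_Ioo (by linarith [min_le_left δ₁ δ₂]) (by linarith [min_le_left δ₁ δ₂])
  have hJ₂ : J ⊆ Set.Ioo (p 0 - δ₂) (p 0 + δ₂) :=
    Set.Ioo_subset_Ioo (by linarith [min_le_right δ₁ δ₂]) (by linarith [min_le_right δ₁ δ₂])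
  have hJI : J ⊆ I := hJ₁.trans hI₁
  have hpJ : p 0 ∈ J := ⟨by linarith, by linarith⟩
  have hdet : ∀ t ∈ J, A t * D t - B t * C t = 1 := by
    intro t ht
    have h2 : ∀ s ∈ J, HasDerivAt (fun s => A s * D s - B s * C s) 0 s := fun s hs =>
      (((hAB s (hJ₁ hs)).1.fun_mul (hCD s (hJ₂ hs)).2).fun_sub
        ((hAB s (hJ₁ hs)).2.fun_mul (hCD s (hJ₂ hs)).1)).congr_deriv (by ring)
    have h3 := isOpen_Ioo.is_const_of_deriv_eq_zero isPreconnected_Ioo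
      (fun s hs => (h2 s hs).differentiableAt.differentiableWithinAt)
      (fun s hs => (h2 s hs).deriv) ht hpJ
    have h4 : A t * D t - B t * C t = A (p 0) * D (p 0) - B (p 0) * C (p 0) := h3
    rw [h4, hA0, hB0, hC0, hD0]
    ring
  -- everything depending on the time alone, as a function on `J × ℝⁿ`
  let T : Set (Point n) := {q | q 0 ∈ J}
  have hT : IsOpen T := isOpen_Ioo.preimage (continuous_apply 0)
  have lift : ∀ f : ℝ → ℝ, ContDiffOn ℝ ∞ f J → ContDiffOn ℝ ∞ (fun q : Point n => f (q 0)) T :=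
    fun f hf => hf.comp (contDiff_apply ℝ ℝ (0 : Fin (n + 1))).contDiffOn fun q hq => hq
  have hA' := lift A (hA.mono hJ₁)
  have hB' := lift B (hB.mono hJ₁)
  have hC' := lift C (hC.mono hJ₂)
  have hD' := lift D (hD.mono hJ₂)
  have ha' := lift a (h.smooth_a.mono hJI)
  have hk' := lift k (h.smooth_k.mono hJI)
  have hρ : ContDiffOn ℝ ∞ (radiusSq : Point n → ℝ) T := contDiff_radiusSq.contDiffOn
  have hm' := (hD'.pow 2).sub ((hC'.pow 2).mul hρ)
  have hf' := (contDiffOn_const (c := (1 : ℝ))).add (hk'.mul hρ)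
  let W : Set (Point n) := T ∩ (fun q : Point n => (radiusSq q, 1 + k (q 0) * radiusSq q,
    D (q 0) ^ 2 - C (q 0) ^ 2 * radiusSq q)) ⁻¹' (Set.Ioi 0 ×ˢ Set.Ioi 0 ×ˢ {0}ᶜ)
  have hW : IsOpen W :=
    (hρ.continuousOn.prodMk (hf'.continuousOn.prodMk hm'.continuousOn)).isOpen_inter_preimage hT
      (isOpen_Ioi.prod (isOpen_Ioi.prod isOpen_compl_singleton))
  have hWT : W ⊆ T := Set.inter_subset_left
  have hWρ : ∀ q ∈ W, 0 < radiusSq q := fun q hq => hq.2.1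
  have hWf : ∀ q ∈ W, 0 < 1 + k (q 0) * radiusSq q := fun q hq => hq.2.2.1
  have hWm : ∀ q ∈ W, D (q 0) ^ 2 - C (q 0) ^ 2 * radiusSq q ≠ 0 := fun q hq => hq.2.2.2
  have hWa : ∀ q ∈ W, 0 < a (q 0) := fun q hq => h.pos_a _ (hJI (hWT hq))
  have hpW : p ∈ W := ⟨hpJ, hp'.2.1, hp'.2.2, by simp [hC0, hD0]⟩
  have hφ : ContDiffOn ℝ ∞ (mobiusMap n A B C D) W := by
    rw [contDiffOn_pi]
    intro j
    refine Fin.cases ?_ (fun i => ?_) j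
    · exact (((hB'.mul hD').sub ((hA'.mul hC').mul hρ)).mono hWT).div (hm'.mono hWT) hWm
    · exact (contDiff_apply ℝ ℝ i.succ).contDiffOn.div (hm'.mono hWT) hWm
  have hpull : ∀ q ∈ W, ∀ v w, conformal n a k q v w =
      4 * a (q 0) ^ 2 * (D (q 0) ^ 2 - C (q 0) ^ 2 * radiusSq q) ^ 2 /
        (1 + k (q 0) * radiusSq q) ^ 2 *
        pullback (mobiusMap n A B C D) (minkowski n) q v w := by
    intro q hq v w
    have h1 := pullback_mobiusMap (hAB _ (hJ₁ (hWT hq))).1 (hAB _ (hJ₁ (hWT hq))).2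
      (hCD _ (hJ₂ (hWT hq))).1 (hCD _ (hJ₂ (hWT hq))).2 (hdet _ (hWT hq)) (hWm q hq)
      (differentiableAt_of_contDiffOn hW hφ hq) v w
    have h2 := (hWf q hq).ne'
    have h3 := (hWa q hq).ne'
    rw [conformal_eq _ _ (hWρ q hq), mul_div_right_comm (4 * a (q 0) ^ 2),
      mul_assoc (4 * a (q 0) ^ 2 / _), h1]
    field_simp
    ring
  have hinj : ∀ q ∈ W, ∀ v, fderiv ℝ (mobiusMap n A B C D) q v = 0 → v = 0 := by
    intro q hq v hv
    have h0 : ∀ w, conformal n a k q v w = 0 := fun w => by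
      rw [hpull q hq, pullback, hv]
      simp [minkowski]
    have h2 := (hWf q hq).ne'
    have h3 := (hWa q hq).ne'
    refine minkowski_nondeg (p := 0) fun w => ?_
    -- rescaling the time component of `w` turns the metric into the Minkowski metric
    have h1 := h0 fun i => if i = 0 then 4 * a (q 0) ^ 2 / (1 + k (q 0) * radiusSq q) ^ 2 * w 0
      else w i
    rw [conformal_eq _ _ (hWρ q hq)] at h1
    simp only [spatial, Fin.succ_ne_zero, if_false, if_true] at h1
    have h4 : 4 * a (q 0) ^ 2 / (1 + k (q 0) * radiusSq q) ^ 2 ≠ 0 := by positivity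
    apply mul_left_cancel₀ h4
    rw [minkowski, mul_zero, ← h1]
    ring
  obtain ⟨φ, hφd, hpφ, hφW, hφe⟩ := exists_isDiffeo hW hφ hinj hpW
  refine ⟨φ, fun q => 4 * a (q 0) ^ 2 * (D (q 0) ^ 2 - C (q 0) ^ 2 * radiusSq q) ^ 2 /
    (1 + k (q 0) * radiusSq q) ^ 2, hφd, hpφ, fun q hq => ?_, ?_, fun q hq => ⟨?_, fun v w => ?_⟩⟩
  · exact mem_conformalDomain_iff.2
      ⟨hJI (hWT (hφW hq)), hWρ q (hφW hq), hWf q (hφW hq)⟩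
  · exact ((((contDiffOn_const.mul (ha'.pow 2)).mul (hm'.pow 2)).mono hWT).div
      ((hf'.pow 2).mono hWT) fun q hq => pow_ne_zero 2 (hWf q hq).ne').mono hφW
  · have h1 := hWf q (hφW hq)
    have h2 := hWa q (hφW hq)
    have h3 := hWm q (hφW hq)
    positivity
  · rw [hφe]
    exact hpull q (hφW hq) v w

/-! ### Spherically symmetric metrics -/

theorem spatial_comm {n : ℕ} (v w : Point n) : spatial v w = spatial w v := by
  simp only [spatial, mul_comm]

theorem spatial_add_left {n : ℕ} (v v' w : Point n) :
    spatial (v + v') w = spatial v w + spatial v' w := by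
  simp only [spatial, Pi.add_apply, add_mul, Finset.sum_add_distrib]

theorem spatial_smul_left {n : ℕ} (c : ℝ) (v w : Point n) :
    spatial (c • v) w = c * spatial v w := by
  simp only [spatial, Pi.smul_apply, smul_eq_mul, mul_assoc, Finset.mul_sum]

theorem spatial_self {n : ℕ} (v : Point n) : spatial v v = radiusSq v := by
  simp only [spatial, radiusSq, pow_two]

/-- The coordinate vector `∂_t`. -/
def timeVec (n : ℕ) : Point n := Pi.single 0 1

@[simp] theorem timeVec_zero {n : ℕ} : timeVec n 0 = 1 := by simp [timeVec]

@[simp] theorem spatial_timeVec {n : ℕ} (v : Point n) : spatial v (timeVec n) = 0 := by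
  simp [spatial, timeVec]

@[simp] theorem spatial_timeVec' {n : ℕ} (v : Point n) : spatial (timeVec n) v = 0 := by
  rw [spatial_comm, spatial_timeVec]

/-- The spatial part of a vector. -/
def spacePart {n : ℕ} (v : Point n) : Point n := v - v 0 • timeVec n

@[simp] theorem spacePart_zero {n : ℕ} (v : Point n) : spacePart v 0 = 0 := by
  simp [spacePart]

@[simp] theorem spatial_spacePart {n : ℕ} (v w : Point n) :
    spatial v (spacePart w) = spatial v w := by
  simp [spatial, spacePart, timeVec]

@[simp] theorem spatial_spacePart' {n : ℕ} (v w : Point n) :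
    spatial (spacePart v) w = spatial v w := by
  rw [spatial_comm, spatial_spacePart, spatial_comm]

theorem eq_spacePart_add {n : ℕ} (v : Point n) : v = spacePart v + v 0 • timeVec n := by
  simp [spacePart]

theorem radiusSq_line {n : ℕ} (p v : Point n) (s : ℝ) :
    radiusSq (p + s • v) = radiusSq p + 2 * s * spatial p v + s ^ 2 * spatial v v := by
  simp only [← spatial_self, spatial_add_left, spatial_smul_left]
  rw [spatial_comm p (p + s • v), spatial_comm v (p + s • v)]
  simp only [spatial_add_left, spatial_smul_left, spatial_comm v p]
  ring

/-- Two orthonormal spatial vectors orthogonal to `p`. -/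
theorem exists_orthonormal_pair {n : ℕ} (hn : 3 ≤ n) (p : Point n) :
    ∃ f f' : Point n, f 0 = 0 ∧ f' 0 = 0 ∧ spatial p f = 0 ∧ spatial p f' = 0 ∧
      spatial f f = 1 ∧ spatial f' f' = 1 ∧ spatial f f' = 0 := by
  let x : EuclideanSpace ℝ (Fin n) := WithLp.toLp 2 fun i => p i.succ
  let K : Submodule ℝ (EuclideanSpace ℝ (Fin n)) := (ℝ ∙ x)ᗮ
  have hK : 2 ≤ Module.finrank ℝ K := by
    have h1 := Submodule.finrank_add_finrank_orthogonal (ℝ ∙ x)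
    have h2 : Module.finrank ℝ (ℝ ∙ x) ≤ 1 := by
      simpa using finrank_span_le_card (R := ℝ) ({x} : Set (EuclideanSpace ℝ (Fin n)))
    rw [finrank_euclideanSpace_fin] at h1
    change 2 ≤ Module.finrank ℝ ↥(ℝ ∙ x)ᗮ
    omega
  let b := stdOrthonormalBasis ℝ K
  let y : EuclideanSpace ℝ (Fin n) → Point n := fun z => Fin.cons 0 fun i => z i
  have hy : ∀ z z', spatial (y z) (y z') = inner ℝ z z' := fun z z' => by
    simp [spatial, y, PiLp.inner_apply, mul_comm]
  have hx : ∀ z : K, spatial p (y z) = 0 := fun z => by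
    have h1 : inner ℝ x (z : EuclideanSpace ℝ (Fin n)) = 0 :=
      Submodule.mem_orthogonal_singleton_iff_inner_right.1 z.2
    rw [← h1]
    simp [spatial, y, x, PiLp.inner_apply, mul_comm]
  have hb := b.orthonormal
  let i : Fin (Module.finrank ℝ K) := ⟨0, by omega⟩
  let j : Fin (Module.finrank ℝ K) := ⟨1, by omega⟩
  have hbb : ∀ i j, spatial (y (b i)) (y (b j)) = if i = j then 1 else 0 := fun i j => by
    rw [hy]
    exact (orthonormal_iff_ite.1 hb) i j
  refine ⟨y (b i), y (b j), rfl, rfl, hx _, hx _, ?_, ?_, ?_⟩ <;> rw [hbb] <;> simp [i, j]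

/-- The spherically symmetric metric `-dt² + u |dx|² + w (x · dx)²`, the coefficients being
functions of `t` and of `|x|²`. -/
def spherical (n : ℕ) (u w : ℝ → ℝ → ℝ) : TensorField n := fun p v v' =>
  -(v 0 * v' 0) + u (p 0) (radiusSq p) * spatial v v'
    + w (p 0) (radiusSq p) * (spatial p v * spatial p v')

/-- The product rule at a zero of the first factor needs no differentiability of the second one. -/
theorem hasDerivAt_id_mul_of_continuousAt {c : ℝ → ℝ} (hc : ContinuousAt c 0) :
    HasDerivAt (fun s => s * c s) (c 0) 0 := by
  rw [hasDerivAt_iff_tendsto_slope]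
  refine (hc.tendsto.mono_left nhdsWithin_le_nhds).congr' ?_
  filter_upwards [self_mem_nhdsWithin] with s hs
  have : s ≠ 0 := hs
  simp [slope_def_field]
  field_simp

/-- The sectional curvature part of the Gauss equation, for constant vector fields. -/
theorem IsNullLift.gauss_along {n : ℕ} {F : Type*} [NormedAddCommGroup F] [NormedSpace ℝ F]
    {B : F →L[ℝ] F →L[ℝ] ℝ} {Φ : Point n → F} {g : TensorField n} {U : Set (Point n)}
    (h : IsNullLift B Φ g U) {p : Point n} (hp : p ∈ U) (v w : Point n) :
    B (along v (along v Φ) p) (along w (along w Φ) p)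
        - B (along v (along w Φ) p) (along v (along w Φ) p) =
      along w (fun q => B (along v (along v Φ) q) (along w Φ q)) p
        - along v (fun q => B (along v (along w Φ) q) (along w Φ q)) p := by
  rw [along_bilin B (h.diff₂ hp v v) (h.diff₁ hp w), along_bilin B (h.diff₂ hp v w) (h.diff₁ hp w),
    h.comm₃ hp w v v, along_congr (f := along w (along v Φ)) (g := along v (along w Φ))
      (Filter.eventually_of_mem (h.isOpen.mem_nhds hp) fun q hq => h.comm₂ hq w v)]
  ring

/-- The coefficients of the metric on `U` are those of a spherically symmetric metric, with the
given partial derivatives with respect to `t` and to `|x|²`. -/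
structure IsSpherical {n : ℕ} (g : TensorField n) (U : Set (Point n))
    (u w ut ur wt wr : ℝ → ℝ → ℝ) : Prop where
  eq : ∀ q ∈ U, ∀ v v', g q v v' = spherical n u w q v v'
  ut : ∀ q ∈ U, HasDerivAt (fun t => u t (radiusSq q)) (ut (q 0) (radiusSq q)) (q 0)
  ur : ∀ q ∈ U, HasDerivAt (u (q 0)) (ur (q 0) (radiusSq q)) (radiusSq q)
  wt : ∀ q ∈ U, HasDerivAt (fun t => w t (radiusSq q)) (wt (q 0) (radiusSq q)) (q 0)
  wr : ∀ q ∈ U, HasDerivAt (w (q 0)) (wr (q 0) (radiusSq q)) (radiusSq q)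

namespace IsNullLift

variable {n : ℕ} {F : Type*} [NormedAddCommGroup F] [NormedSpace ℝ F]
  {B : F →L[ℝ] F →L[ℝ] ℝ} {Φ : Point n → F} {g : TensorField n} {U : Set (Point n)}
  {u w ut ur wt wr : ℝ → ℝ → ℝ}

theorem differentiableAt_metric (h : IsNullLift B Φ g U) {q : Point n} (hq : q ∈ U)
    (v w : Point n) : DifferentiableAt ℝ (fun x => g x v w) q :=
  (differentiableAt_of_contDiffOn h.isOpen
    (contDiffOn_bilin B (h.smooth₁ v) (h.smooth₁ w)) hq).congr_of_eventuallyEq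
      (Filter.eventually_of_mem (h.isOpen.mem_nhds hq) fun x hx => (h.metric x hx v w).symm)

theorem differentiableAt_koszul (h : IsNullLift B Φ g U) {q : Point n} (hq : q ∈ U)
    (v w z : Point n) :
    DifferentiableAt ℝ (fun x => B (along v (along w Φ) x) (along z Φ x)) q :=
  differentiableAt_of_contDiffOn h.isOpen (contDiffOn_bilin B (h.smooth₂ v w) (h.smooth₁ z)) hq

theorem along_time_metric (h : IsNullLift B Φ g U) (hs : IsSpherical g U u w ut ur wt wr)
    {q : Point n} (hq : q ∈ U) (y z : Point n) :
    along (timeVec n) (fun x => g x y z) q = ut (q 0) (radiusSq q) * spatial y z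
      + wt (q 0) (radiusSq q) * (spatial q y * spatial q z) := by
  have hc := ((hasDerivAt_line_time (hs.ut q hq) (timeVec n)).mul_const (spatial y z)).fun_add
    ((hasDerivAt_line_time (hs.wt q hq) (timeVec n)).mul_const (spatial q y * spatial q z))
  refine along_eq_of_line (h.differentiableAt_metric hq y z)
    ((hc.const_add (-(y 0 * z 0))).congr_deriv (by simp)) ?_
  filter_upwards [eventually_line h.isOpen hq (timeVec n)] with s hsU
  rw [hs.eq _ hsU]
  simp only [spherical, radiusSq_line, spatial_add_left, spatial_smul_left, spatial_timeVec,
    spatial_timeVec']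
  simp only [mul_zero, add_zero]
  ring

theorem along_space_metric (h : IsNullLift B Φ g U) (hs : IsSpherical g U u w ut ur wt wr)
    {q : Point n} (hq : q ∈ U) {v : Point n} (hv : v 0 = 0) (y z : Point n) :
    along v (fun x => g x y z) q =
      ur (q 0) (radiusSq q) * (2 * spatial q v) * spatial y z
      + (wr (q 0) (radiusSq q) * (2 * spatial q v) * (spatial q y * spatial q z)
        + w (q 0) (radiusSq q) * (spatial v y * spatial q z + spatial q y * spatial v z)) := by
  have h0 : radiusSq (q + (0 : ℝ) • v) = radiusSq q := by simp
  have hρ := hasDerivAt_line_radiusSq q v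
  have hu : HasDerivAt (fun s : ℝ => u (q 0) (radiusSq (q + s • v)))
      (ur (q 0) (radiusSq q) * (2 * spatial q v)) 0 :=
    HasDerivAt.comp (0 : ℝ) (by rw [h0]; exact hs.ur q hq) hρ
  have hw : HasDerivAt (fun s : ℝ => w (q 0) (radiusSq (q + s • v)))
      (wr (q 0) (radiusSq q) * (2 * spatial q v)) 0 :=
    HasDerivAt.comp (0 : ℝ) (by rw [h0]; exact hs.wr q hq) hρ
  have hl : ∀ y : Point n, HasDerivAt (fun s : ℝ => spatial q y + s * spatial v y)
      (spatial v y) 0 := fun y => by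
    simpa using ((hasDerivAt_id (0 : ℝ)).mul_const (spatial v y)).const_add (spatial q y)
  have hc := (hu.mul_const (spatial y z)).fun_add (hw.fun_mul ((hl y).fun_mul (hl z)))
  refine along_eq_of_line (h.differentiableAt_metric hq y z)
    ((hc.const_add (-(y 0 * z 0))).congr_deriv (by simp)) ?_
  filter_upwards [eventually_line h.isOpen hq v] with s hsU
  rw [hs.eq _ hsU]
  simp only [spherical, spatial_add_left, spatial_smul_left, Pi.add_apply, Pi.smul_apply, hv,
    smul_zero, add_zero]
  ring

theorem koszul_space (h : IsNullLift B Φ g U) (hs : IsSpherical g U u w ut ur wt wr)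
    {q : Point n} (hq : q ∈ U) {x y z : Point n} (hx : x 0 = 0) (hy : y 0 = 0) (hz : z 0 = 0) :
    B (along x (along y Φ) q) (along z Φ q) =
      ur (q 0) (radiusSq q) * (spatial q x * spatial y z + spatial q y * spatial x z
        - spatial q z * spatial x y)
      + wr (q 0) (radiusSq q) * (spatial q x * spatial q y * spatial q z)
      + w (q 0) (radiusSq q) * (spatial x y * spatial q z) := by
  rw [h.koszul hq, h.along_space_metric hs hq hx, h.along_space_metric hs hq hy,
    h.along_space_metric hs hq hz, spatial_comm z x, spatial_comm z y, spatial_comm y x]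
  ring

theorem koszul_space_time (h : IsNullLift B Φ g U) (hs : IsSpherical g U u w ut ur wt wr)
    {q : Point n} (hq : q ∈ U) {x y : Point n} (hx : x 0 = 0) (hy : y 0 = 0) :
    B (along x (along y Φ) q) (along (timeVec n) Φ q) =
      -(1 / 2) * (ut (q 0) (radiusSq q) * spatial x y
        + wt (q 0) (radiusSq q) * (spatial q x * spatial q y)) := by
  rw [h.koszul hq, h.along_space_metric hs hq hx, h.along_space_metric hs hq hy,
    h.along_time_metric hs hq]
  simp only [spatial_timeVec]
  ring

theorem koszul_mixed (h : IsNullLift B Φ g U) (hs : IsSpherical g U u w ut ur wt wr)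
    {q : Point n} (hq : q ∈ U) {x z : Point n} (hx : x 0 = 0) (hz : z 0 = 0) :
    B (along (timeVec n) (along x Φ) q) (along z Φ q) =
      1 / 2 * (ut (q 0) (radiusSq q) * spatial x z
        + wt (q 0) (radiusSq q) * (spatial q x * spatial q z)) := by
  rw [h.koszul hq, h.along_space_metric hs hq hx, h.along_space_metric hs hq hz,
    h.along_time_metric hs hq]
  simp

theorem koszul_mixed_time (h : IsNullLift B Φ g U) (hs : IsSpherical g U u w ut ur wt wr)
    {q : Point n} (hq : q ∈ U) {x : Point n} (hx : x 0 = 0) :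
    B (along (timeVec n) (along x Φ) q) (along (timeVec n) Φ q) = 0 := by
  rw [h.koszul hq, h.along_space_metric hs hq hx]
  simp [h.along_time_metric hs hq]

theorem koszul_time (h : IsNullLift B Φ g U) (hs : IsSpherical g U u w ut ur wt wr)
    {q : Point n} (hq : q ∈ U) (z : Point n) :
    B (along (timeVec n) (along (timeVec n) Φ) q) (along z Φ q) = 0 := by
  have hadd : along z Φ q = along (spacePart z) Φ q + z 0 • along (timeVec n) Φ q := by
    conv_lhs => rw [eq_spacePart_add z]
    simp only [along, map_add, map_smul]
  rw [hadd, map_add, map_smul, h.koszul hq, h.koszul hq,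
    h.along_space_metric hs hq (spacePart_zero z)]
  simp only [h.along_time_metric hs hq]
  simp

/-- A vector is normal as soon as it is orthogonal to the spatial directions and to `∂_t`. -/
theorem normal_of_space_time {x : F} {q : Point n}
    (hspace : ∀ z : Point n, z 0 = 0 → B x (along z Φ q) = 0)
    (htime : B x (along (timeVec n) Φ q) = 0) (z : Point n) : B x (along z Φ q) = 0 := by
  have hadd : along z Φ q = along (spacePart z) Φ q + z 0 • along (timeVec n) Φ q := by
    conv_lhs => rw [eq_spacePart_add z]
    simp only [along, map_add, map_smul]
  rw [hadd, map_add, map_smul, hspace _ (spacePart_zero z), htime]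
  simp

/-- Products of second derivatives `∂_v ∂_w Φ` with tangential parts `∂_c Φ` are determined by the
metric and by the component `P` of the normal part along the second null normal. -/
theorem exists_second_mul_second [FiniteDimensional ℝ F] (h : IsNullLift B Φ g U) {p : Point n}
    (hp : p ∈ U) :
    ∃ P : Point n → Point n → Point n → ℝ, ∀ v w c v' w' c' : Point n,
      (∀ z, B (along v (along w Φ) p - along c Φ p) (along z Φ p) = 0) →
      (∀ z, B (along v' (along w' Φ) p - along c' Φ p) (along z Φ p) = 0) →
      B (along v (along w Φ) p) (along v' (along w' Φ) p) =
        g p c c' - (g p v w * P v' w' c' + P v w c * g p v' w') := by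
  obtain ⟨N, hN⟩ := h.exists_normal hp
  refine ⟨fun v w c => B (along v (along w Φ) p - along c Φ p) N,
    fun v w c v' w' c' hc hc' => ?_⟩
  have h1 := hN _ _ hc hc'
  have hΦ : ∀ v w c, B (along v (along w Φ) p - along c Φ p) (Φ p) = -g p v w := by
    intro v w c
    rw [map_sub, sub_apply, h.second_position hp, h.symm, h.orth hp, sub_zero]
  rw [hΦ, hΦ] at h1
  have h2 := hc c'
  have h3 := hc' c
  have h4 := h.metric p hp c c'
  have h5 := h.symm (along c Φ p) (along v' (along w' Φ) p)
  have h6 := h.symm (along c Φ p) (along c' Φ p)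
  simp only [map_sub, sub_apply] at h1 h2 h3 ⊢
  linarith

/-- A necessary condition on the coefficients of a spherically symmetric metric for conformal
flatness. It is the equation `K(t, f') + K(e, f) = K(t, e) + K(f, f')` between sectional
curvatures, for the radial direction `e` and two orthogonal angular directions `f`, `f'`. Here `Q`
is the coefficient of `dr²`. -/
theorem spherical_identity [FiniteDimensional ℝ F] (hn : 3 ≤ n) (h : IsNullLift B Φ g U)
    (hs : IsSpherical g U u w ut ur wt wr) {p : Point n} (hp : p ∈ U)
    {U₀ W₀ Ut Ur Wt Wr Utt Urr Wtt ρ Q : ℝ} (hρ : radiusSq p = ρ)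
    (hU₀ : u (p 0) ρ = U₀) (hW₀ : w (p 0) ρ = W₀) (hUt : ut (p 0) ρ = Ut)
    (hUr : ur (p 0) ρ = Ur) (hWt : wt (p 0) ρ = Wt) (hWr : wr (p 0) ρ = Wr)
    (hUtt : HasDerivAt (fun t => ut t ρ) Utt (p 0))
    (hWtt : HasDerivAt (fun t => wt t ρ) Wtt (p 0))
    (hUrr : HasDerivAt (ur (p 0)) Urr ρ) (hWrc : ContinuousAt (wr (p 0)) ρ)
    (hQ : Q = U₀ + W₀ * ρ) (hρ0 : ρ ≠ 0) (hU0 : U₀ ≠ 0) (hQ0 : Q ≠ 0) :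
    ρ * Q * (W₀ - 2 * Ur - (W₀ - Ur) ^ 2 * ρ / Q + Ut ^ 2 / 4) =
      U₀ * ((-(2 * ρ ^ 2 * Urr) - 2 * ρ * Ur + ρ ^ 2 * Wr + ρ * W₀
          - ρ ^ 2 * (Ur + W₀ + Wr * ρ) * (W₀ - Ur) / Q
          + ρ * (Ut + Wt * ρ) * Ut / 4 + Ur ^ 2 * ρ ^ 2 / U₀)
        + U₀ * (ρ * (-(Utt + Wtt * ρ) / 2 + (Ut + Wt * ρ) ^ 2 / (4 * Q)))
        - ρ * Q * (-Utt / 2 + Ut ^ 2 / (4 * U₀))) := by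
  obtain ⟨f, f', hf0, hf0', hpf, hpf', hff, hff', hfff⟩ := exists_orthonormal_pair hn p
  have hfff' : spatial f' f = 0 := by rw [spatial_comm, hfff]
  have hfp : spatial f p = 0 := by rw [spatial_comm, hpf]
  have hpp : spatial p p = ρ := by rw [spatial_self, hρ]
  set e := spacePart p with he
  have he0 : e 0 = 0 := spacePart_zero p
  set T := timeVec n with hT
  have hT0 : T 0 = 1 := timeVec_zero
  have hTs : ∀ v, spatial T v = 0 := spatial_timeVec'
  have hsT : ∀ v, spatial v T = 0 := spatial_timeVec
  have hes : ∀ v, spatial e v = spatial p v := fun v => spatial_spacePart' p v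
  have hse : ∀ v, spatial v e = spatial v p := fun v => spatial_spacePart v p
  have hg : ∀ v v', g p v v' = -(v 0 * v' 0) + U₀ * spatial v v'
      + W₀ * (spatial p v * spatial p v') := fun v v' => by
    rw [hs.eq p hp, spherical, hρ, hU₀, hW₀]
  have hcomb : ∀ (a b : ℝ) (v v' z : Point n), g p (a • v + b • v') z =
      a * g p v z + b * g p v' z := fun a b v v' z => by
    simp only [← h.metric p hp, along, map_add, map_smul, add_apply, smul_apply, smul_eq_mul]
  have hKs : ∀ {x y z : Point n}, x 0 = 0 → y 0 = 0 → z 0 = 0 →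
      B (along x (along y Φ) p) (along z Φ p) =
      Ur * (spatial p x * spatial y z + spatial p y * spatial x z - spatial p z * spatial x y)
        + Wr * (spatial p x * spatial p y * spatial p z) + W₀ * (spatial x y * spatial p z) := by
    intro x y z hx hy hz
    rw [h.koszul_space hs hp hx hy hz, hρ, hUr, hWr, hW₀]
  have hKst : ∀ {x y : Point n}, x 0 = 0 → y 0 = 0 → B (along x (along y Φ) p) (along T Φ p) =
      -(1 / 2) * (Ut * spatial x y + Wt * (spatial p x * spatial p y)) := by
    intro x y hx hy
    rw [h.koszul_space_time hs hp hx hy, hρ, hUt, hWt]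
  have hKm : ∀ {x z : Point n}, x 0 = 0 → z 0 = 0 → B (along T (along x Φ) p) (along z Φ p) =
      1 / 2 * (Ut * spatial x z + Wt * (spatial p x * spatial p z)) := by
    intro x z hx hz
    rw [h.koszul_mixed hs hp hx hz, hρ, hUt, hWt]
  have hKmt : ∀ {x : Point n}, x 0 = 0 → B (along T (along x Φ) p) (along T Φ p) = 0 :=
    fun hx => h.koszul_mixed_time hs hp hx
  have hnormal : ∀ (v v' x : Point n) (a b : ℝ),
      (∀ z, z 0 = 0 → B (along v (along v' Φ) p) (along z Φ p) = a * g p x z + b * g p T z) →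
      B (along v (along v' Φ) p) (along T Φ p) = a * g p x T + b * g p T T →
      ∀ z, B (along v (along v' Φ) p - along (a • x + b • T) Φ p) (along z Φ p) = 0 := by
    intro v v' x a b h1 h2
    refine normal_of_space_time (fun z hz => ?_) ?_ <;>
      rw [map_sub, sub_apply, h.metric p hp, hcomb, sub_eq_zero]
    exacts [h1 z hz, h2]
  -- the tangential components of the second derivatives
  have ntt := hnormal T T e 0 0 (fun z _ => by rw [h.koszul_time hs hp]; simp)
    (by rw [h.koszul_time hs hp]; simp)
  have ntf : ∀ f : Point n, f 0 = 0 → spatial p f = 0 →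
      ∀ z, B (along T (along f Φ) p - along ((Ut / (2 * U₀)) • f + (0 : ℝ) • T) Φ p)
        (along z Φ p) = 0 := fun f hf0 hpf =>
    hnormal _ _ _ _ _ (fun z hz => by
      rw [hKm hf0 hz, hg, hg]
      simp only [hf0, hpf, hz, hTs]
      field_simp
      ring) (by rw [hKmt hf0, hg, hg]; simp [hf0, hpf, hsT])
  have nte := hnormal T e e ((Ut + Wt * ρ) / (2 * Q)) 0 (fun z hz => by
      rw [hKm he0 hz, hg, hg]
      simp only [he0, hes, hse, hpp, hz, hTs]
      field_simp
      rw [hQ]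
      ring) (by rw [hKmt he0, hg, hg]; simp [he0, hsT])
  have nff : ∀ f : Point n, f 0 = 0 → spatial p f = 0 → spatial f f = 1 →
      ∀ z, B (along f (along f Φ) p - along (((W₀ - Ur) / Q) • e + (Ut / 2) • T) Φ p)
        (along z Φ p) = 0 := fun f hf0 hpf hff =>
    hnormal _ _ _ _ _ (fun z hz => by
      rw [hKs hf0 hf0 hz, hg, hg]
      simp only [he0, hes, hse, hpp, hz, hTs, hpf, hff, hT0, hsT]
      field_simp
      rw [hQ]
      ring) (by
      rw [hKst hf0 hf0, hg, hg]
      simp only [he0, hpf, hff, hT0, hsT]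
      ring)
  have nff' := hnormal f f' e 0 0 (fun z hz => by
      rw [hKs hf0 hf0' hz]; simp [hpf, hpf', hfff])
    (by rw [hKst hf0 hf0']; simp [hpf, hfff])
  have nee := hnormal e e e (ρ * (Ur + W₀ + Wr * ρ) / Q) (ρ * (Ut + Wt * ρ) / 2) (fun z hz => by
      rw [hKs he0 he0 hz, hg, hg]
      simp only [he0, hes, hse, hpp, hz, hTs, hT0, hsT]
      field_simp
      rw [hQ]
      ring) (by
      rw [hKst he0 he0, hg, hg]
      simp only [he0, hes, hse, hpp, hT0, hsT]
      ring)
  have nef := hnormal e f f (Ur * ρ / U₀) 0 (fun z hz => by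
      rw [hKs he0 hf0 hz, hg, hg]
      simp only [hes, hse, hpp, hpf, hf0, hz, hTs]
      field_simp
      ring) (by
      rw [hKst he0 hf0, hg, hg]
      simp [hes, hpf, hf0, hsT])
  -- the intrinsic parts of the sectional curvatures
  have gtf : ∀ f : Point n, f 0 = 0 → spatial p f = 0 → spatial f f = 1 →
      B (along T (along T Φ) p) (along f (along f Φ) p)
        - B (along T (along f Φ) p) (along T (along f Φ) p) = -(1 / 2 * Utt) := by
    intro f hf0 hpf hff
    rw [h.gauss_along hp, h.along_eq_of_eqOn hp (fun q hq => h.koszul_time hs hq f) f]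
    have h1 : along f (fun _ : Point n => (0 : ℝ)) p = 0 := by simp [along]
    rw [h1, along_eq_of_line (h.differentiableAt_koszul hp T f f)
      (((hasDerivAt_line_time hUtt T).const_mul (1 / 2 : ℝ)).congr_deriv (by rw [hT0, mul_one]))]
    · ring
    · filter_upwards [eventually_line h.isOpen hp T] with s hsU
      rw [h.koszul_mixed hs hsU hf0 hf0]
      simp [radiusSq_line, spatial_add_left, spatial_smul_left, hsT, hTs, hpf, hff, hρ]
  have gte : B (along T (along T Φ) p) (along e (along e Φ) p)
        - B (along T (along e Φ) p) (along T (along e Φ) p) =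
        -(1 / 2 * (Utt * ρ + Wtt * ρ ^ 2)) := by
    rw [h.gauss_along hp, h.along_eq_of_eqOn hp (fun q hq => h.koszul_time hs hq e) e]
    have h1 : along e (fun _ : Point n => (0 : ℝ)) p = 0 := by simp [along]
    rw [h1, along_eq_of_line (h.differentiableAt_koszul hp T e e)
      (((((hasDerivAt_line_time hUtt T).mul_const ρ).fun_add
        ((hasDerivAt_line_time hWtt T).mul_const (ρ ^ 2))).const_mul (1 / 2 : ℝ)).congr_deriv
        (by rw [hT0, mul_one, mul_one]))]
    · ring
    · filter_upwards [eventually_line h.isOpen hp T] with s hsU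
      rw [h.koszul_mixed hs hsU he0 he0]
      simp only [radiusSq_line, spatial_add_left, spatial_smul_left, hsT, hTs, hes, hse, hpp, hρ,
        mul_zero, add_zero]
      ring
  have hW' : ContinuousAt (w (p 0)) ρ := by rw [← hρ]; exact (hs.wr p hp).continuousAt
  have hρs : ContinuousAt (fun s : ℝ => ρ + s ^ 2) 0 := by fun_prop
  have hρs0 : ρ + (0 : ℝ) ^ 2 = ρ := by ring
  have cU : ContinuousAt (fun s : ℝ => ur (p 0) (ρ + s ^ 2)) 0 :=
    ContinuousAt.comp' (by rw [hρs0]; exact hUrr.continuousAt) hρs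
  have cW : ContinuousAt (fun s : ℝ => w (p 0) (ρ + s ^ 2)) 0 :=
    ContinuousAt.comp' (by rw [hρs0]; exact hW') hρs
  have cWr : ContinuousAt (fun s : ℝ => wr (p 0) (ρ + s ^ 2)) 0 :=
    ContinuousAt.comp' (by rw [hρs0]; exact hWrc) hρs
  have gff : B (along f (along f Φ) p) (along f' (along f' Φ) p)
        - B (along f (along f' Φ) p) (along f (along f' Φ) p) = W₀ - 2 * Ur := by
    rw [h.gauss_along hp,
      along_eq_of_line (h.differentiableAt_koszul hp f f f')
        (hasDerivAt_id_mul_of_continuousAt (cW.sub cU)),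
      along_eq_of_line (h.differentiableAt_koszul hp f f' f')
        (hasDerivAt_id_mul_of_continuousAt cU)]
    · simp only [Pi.sub_apply, hρs0, hW₀, hUr]
      ring
    · filter_upwards [eventually_line h.isOpen hp f] with s hsU
      rw [h.koszul_space hs hsU hf0 hf0' hf0']
      simp [radiusSq_line, spatial_add_left, spatial_smul_left, hpf, hpf', hff, hff', hfff,
        hρ, hf0]
      ring
    · filter_upwards [eventually_line h.isOpen hp f'] with s hsU
      rw [h.koszul_space hs hsU hf0 hf0 hf0']
      simp [radiusSq_line, spatial_add_left, spatial_smul_left, hpf, hpf', hff, hff', hfff,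
        hfff', hρ, hf0']
      ring
  have gef : B (along e (along e Φ) p) (along f (along f Φ) p)
        - B (along e (along f Φ) p) (along e (along f Φ) p) =
        -(2 * ρ ^ 2 * Urr) - 2 * ρ * Ur + ρ ^ 2 * Wr + ρ * W₀ := by
    have hl : HasDerivAt (fun s : ℝ => 1 + s) 1 0 := by
      simpa using (hasDerivAt_id (0 : ℝ)).const_add 1
    have hl2 : HasDerivAt (fun s : ℝ => (1 + s) ^ 2 * ρ) (2 * ρ) 0 :=
      ((hl.fun_pow 2).mul_const ρ).congr_deriv (by simp)
    have hu : HasDerivAt (fun s : ℝ => ur (p 0) ((1 + s) ^ 2 * ρ)) (Urr * (2 * ρ)) 0 :=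
      HasDerivAt.comp (0 : ℝ) (by simpa using hUrr) hl2
    rw [h.gauss_along hp,
      along_eq_of_line (h.differentiableAt_koszul hp e e f)
        (hasDerivAt_id_mul_of_continuousAt
          (((cWr.mul_const (ρ ^ 2)).add (cW.mul_const ρ)).sub (cU.mul_const ρ))),
      along_eq_of_line (h.differentiableAt_koszul hp e f f)
        (hu.fun_mul (hl.mul_const ρ))]
    · simp only [hρs0, hW₀, hUr, hWr, Pi.sub_apply, Pi.add_apply, add_zero, one_pow, one_mul]
      ring
    · filter_upwards [eventually_line h.isOpen hp e] with s hsU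
      rw [h.koszul_space hs hsU he0 hf0 hf0]
      have h1 : radiusSq (p + s • e) = (1 + s) ^ 2 * ρ := by
        rw [radiusSq_line, hes, hse, hpp, hρ]
        ring
      simp only [h1, spatial_add_left, spatial_smul_left, hpf, hff, hes, hse, hpp, he0,
        Pi.add_apply, Pi.smul_apply, smul_zero, add_zero]
      ring
    · filter_upwards [eventually_line h.isOpen hp f] with s hsU
      rw [h.koszul_space hs hsU he0 he0 hf0]
      simp [radiusSq_line, spatial_add_left, spatial_smul_left, hpf, hff, hes, hse, hpp, hfp,
        hρ, hf0]
      ring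
  obtain ⟨P, hP⟩ := h.exists_second_mul_second hp
  have e1' := gtf f' hf0' hpf' hff'
  rw [hP _ _ _ _ _ _ ntt (nff f' hf0' hpf' hff'),
    hP _ _ _ _ _ _ (ntf f' hf0' hpf') (ntf f' hf0' hpf')] at e1'
  rw [hP _ _ _ _ _ _ ntt nee, hP _ _ _ _ _ _ nte nte] at gte
  rw [hP _ _ _ _ _ _ (nff f hf0 hpf hff) (nff f' hf0' hpf' hff'),
    hP _ _ _ _ _ _ nff' nff'] at gff
  rw [hP _ _ _ _ _ _ nee (nff f hf0 hpf hff), hP _ _ _ _ _ _ nef nef] at gef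
  generalize P T T _ = Pt at *
  generalize P f f _ = Pf at *
  generalize P f' f' _ = Pf' at *
  generalize P e e _ = Pe at *
  have hgc : ∀ (a b : ℝ) (v z : Point n), g p z (a • v + b • T) =
      a * g p v z + b * g p T z := fun a b v z => by
    rw [← h.metric p hp, h.symm, h.metric p hp, hcomb]
  simp only [hcomb, hgc, hg, he0, hT0, hf0, hf0', hes, hse, hsT, hTs, hpp, hpf, hpf', hff, hff',
    hfff] at e1' gte gff gef
  have k1 : Ut / (2 * U₀) * (Ut / (2 * U₀) * U₀) = Ut ^ 2 / (4 * U₀) := by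
    field_simp
    ring
  have k2 : (Ut + Wt * ρ) / (2 * Q) * ((Ut + Wt * ρ) / (2 * Q) * (U₀ * ρ + W₀ * (ρ * ρ))) =
      ρ * ((Ut + Wt * ρ) ^ 2 / (4 * Q)) := by
    rw [show U₀ * ρ + W₀ * (ρ * ρ) = Q * ρ by rw [hQ]; ring]
    field_simp
    ring
  have k3 : (W₀ - Ur) / Q * ((W₀ - Ur) / Q * (U₀ * ρ + W₀ * (ρ * ρ))) =
      (W₀ - Ur) ^ 2 * ρ / Q := by
    rw [show U₀ * ρ + W₀ * (ρ * ρ) = Q * ρ by rw [hQ]; ring]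
    field_simp
  have k4 : ρ * (Ur + W₀ + Wr * ρ) / Q * ((W₀ - Ur) / Q * (U₀ * ρ + W₀ * (ρ * ρ))) =
      ρ ^ 2 * (Ur + W₀ + Wr * ρ) * (W₀ - Ur) / Q := by
    rw [show U₀ * ρ + W₀ * (ρ * ρ) = Q * ρ by rw [hQ]; ring]
    field_simp
  have k5 : Ur * ρ / U₀ * (Ur * ρ / U₀ * U₀) = Ur ^ 2 * ρ ^ 2 / U₀ := by
    field_simp
  have htf : Pf' = U₀ * Pt + (-Utt / 2 + Ut ^ 2 / (4 * U₀)) := by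
    linear_combination e1' + k1
  have hte : Pe = ρ * Q * Pt
      + ρ * (-(Utt + Wtt * ρ) / 2 + (Ut + Wt * ρ) ^ 2 / (4 * Q)) := by
    linear_combination gte + k2 - ρ * Pt * hQ
  have hff : W₀ - 2 * Ur - (W₀ - Ur) ^ 2 * ρ / Q + Ut ^ 2 / 4 = -(U₀ * (Pf + Pf')) := by
    linear_combination -gff + k3
  have hef : -(2 * ρ ^ 2 * Urr) - 2 * ρ * Ur + ρ ^ 2 * Wr + ρ * W₀
      - ρ ^ 2 * (Ur + W₀ + Wr * ρ) * (W₀ - Ur) / Q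
      + ρ * (Ut + Wt * ρ) * Ut / 4 + Ur ^ 2 * ρ ^ 2 / U₀ = -(ρ * Q * Pf + U₀ * Pe) := by
    linear_combination -gef + k4 - k5 + ρ * Pf * hQ
  linear_combination ρ * Q * hff - U₀ * hef + U₀ ^ 2 * hte - ρ * Q * U₀ * htf

end IsNullLift
theorem IsData.hasDerivAt_k {I : Set ℝ} {a k : ℝ → ℝ} (h : IsData I a k) {t : ℝ} (ht : t ∈ I) :
    HasDerivAt k (deriv k t) t :=
  (differentiableAt_of_contDiffOn h.isOpen h.smooth_k ht).hasDerivAt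

theorem IsData.hasDerivAt_a {I : Set ℝ} {a k : ℝ → ℝ} (h : IsData I a k) {t : ℝ} (ht : t ∈ I) :
    HasDerivAt a (deriv a t) t :=
  (differentiableAt_of_contDiffOn h.isOpen h.smooth_a ht).hasDerivAt

theorem hasDerivAt_deriv_of_contDiffOn {I : Set ℝ} (hI : IsOpen I) {f : ℝ → ℝ}
    (hf : ContDiffOn ℝ ∞ f I) {t : ℝ} (ht : t ∈ I) :
    HasDerivAt (deriv f) (deriv (deriv f) t) t :=
  (differentiableAt_of_contDiffOn hI (hf.deriv_of_isOpen hI (by simp)) ht).hasDerivAt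

/-! ### The radial metric is not locally conformally flat -/

theorem mem_radialDomain_iff {n : ℕ} {I : Set ℝ} {k : ℝ → ℝ} {p : Point n} :
    p ∈ radialDomain n I k ↔
      p 0 ∈ I ∧ 0 < radiusSq p ∧ 0 < 1 - k (p 0) * radiusSq p := by
  rw [← radius_lt_one_div_sqrt_iff p (k (p 0)), ← radius_pos_iff]
  rfl

theorem isSpherical_radial {n : ℕ} {I : Set ℝ} {a k : ℝ → ℝ} (h : IsData I a k)
    {U : Set (Point n)} (hU : U ⊆ radialDomain n I k) :
    IsSpherical (radial n a k) U (fun t _ => a t ^ 2) (fun t ρ => a t ^ 2 * k t / (1 - k t * ρ))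
      (fun t _ => 2 * a t * deriv a t) (fun _ _ => 0)
      (fun t ρ => (2 * a t * deriv a t * k t + a t ^ 2 * deriv k t) / (1 - k t * ρ)
        + a t ^ 2 * k t * (deriv k t * ρ) / (1 - k t * ρ) ^ 2)
      (fun t ρ => a t ^ 2 * k t ^ 2 / (1 - k t * ρ) ^ 2) where
  eq q hq v v' := by
    obtain ⟨-, h1, h2⟩ := mem_radialDomain_iff.1 (hU hq)
    rw [radial, dr_mul_dr, sphereMetric_eq, radius_sq, spherical]
    have h3 := h2.ne'
    field_simp
    ring
  ut q hq := by
    refine ((h.hasDerivAt_a (mem_radialDomain_iff.1 (hU hq)).1).fun_pow 2).congr_deriv ?_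
    simp
  ur q hq := hasDerivAt_const _ _
  wt q hq := by
    obtain ⟨h0, -, h2⟩ := mem_radialDomain_iff.1 (hU hq)
    refine ((((h.hasDerivAt_a h0).fun_pow 2).fun_mul (h.hasDerivAt_k h0)).fun_div
      (((h.hasDerivAt_k h0).mul_const (radiusSq q)).const_sub 1) h2.ne').congr_deriv ?_
    have h3 := h2.ne'
    field_simp
    simp
    ring
  wr q hq := by
    obtain ⟨h0, -, h2⟩ := mem_radialDomain_iff.1 (hU hq)
    refine ((hasDerivAt_const (radiusSq q) (a (q 0) ^ 2 * k (q 0))).fun_div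
      (((hasDerivAt_id' (radiusSq q)).const_mul (k (q 0))).const_sub 1) h2.ne').congr_deriv ?_
    simp
    ring

/-- The curvature condition for the radial metric. -/
theorem radial_identity {n : ℕ} (hn : 3 ≤ n) {I : Set ℝ} {a k : ℝ → ℝ} (h : IsData I a k)
    {F : Type*} [NormedAddCommGroup F] [NormedSpace ℝ F] [FiniteDimensional ℝ F]
    {B : F →L[ℝ] F →L[ℝ] ℝ} {Φ : Point n → F} {U : Set (Point n)}
    (hU : U ⊆ radialDomain n I k) (hΦ : IsNullLift B Φ (radial n a k) U)
    {p : Point n} (hp : p ∈ U) :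
    2 * (deriv (deriv k) (p 0) * a (p 0) + deriv k (p 0) * deriv a (p 0))
        * (1 - k (p 0) * radiusSq p)
      + 3 * deriv k (p 0) ^ 2 * a (p 0) * radiusSq p = 0 := by
  obtain ⟨h0, hρ, hm⟩ := mem_radialDomain_iff.1 (hU hp)
  have hk1 := h.hasDerivAt_k h0
  have ha1 := h.hasDerivAt_a h0
  have hk2 := hasDerivAt_deriv_of_contDiffOn h.isOpen h.smooth_k h0
  have ha2 := hasDerivAt_deriv_of_contDiffOn h.isOpen h.smooth_a h0
  have ha0 := (h.pos_a _ h0).ne'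
  have hm' := hm.ne'
  set ρ := radiusSq p with hρdef
  have hden := (hk1.mul_const ρ).const_sub 1
  have hutt := (ha1.const_mul 2).fun_mul ha2
  have hsq : HasDerivAt (fun t => a t ^ 2) (2 * a (p 0) * deriv a (p 0)) (p 0) :=
    (ha1.fun_pow 2).congr_deriv (by simp)
  have hden2 : HasDerivAt (fun t => (1 - k t * ρ) ^ 2)
      (2 * (1 - k (p 0) * ρ) * -(deriv k (p 0) * ρ)) (p 0) :=
    (hden.fun_pow 2).congr_deriv (by simp)
  have hwtt := (((hutt.fun_mul hk1).fun_add (hsq.fun_mul hk2)).fun_div hden hm').fun_add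
    (((hsq.fun_mul hk1).fun_mul (hk2.mul_const ρ)).fun_div hden2 (pow_ne_zero 2 hm'))
  have hutt' : HasDerivAt (fun t => 2 * a t * deriv a t)
      (2 * deriv a (p 0) ^ 2 + 2 * a (p 0) * deriv (deriv a) (p 0)) (p 0) :=
    hutt.congr_deriv (by ring)
  have hwrc : ContinuousAt (fun r => a (p 0) ^ 2 * k (p 0) ^ 2 / (1 - k (p 0) * r) ^ 2) ρ :=
    ContinuousAt.div (by fun_prop) (by fun_prop) (pow_ne_zero 2 hm')
  have hQ : a (p 0) ^ 2 / (1 - k (p 0) * ρ) =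
      a (p 0) ^ 2 + a (p 0) ^ 2 * k (p 0) / (1 - k (p 0) * ρ) * ρ := by
    field_simp
    ring
  have key := hΦ.spherical_identity hn (isSpherical_radial h hU) hp hρdef.symm rfl rfl rfl rfl rfl
    rfl hutt' hwtt (hasDerivAt_const _ _) hwrc hQ hρ.ne' (pow_ne_zero 2 ha0)
    (div_ne_zero (pow_ne_zero 2 ha0) hm')
  rw [← sub_eq_zero] at key
  generalize deriv (deriv k) (p 0) = k2 at *
  generalize deriv k (p 0) = k1 at *
  generalize deriv (deriv a) (p 0) = a2 at *
  generalize deriv a (p 0) = a1 at *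
  generalize a (p 0) = a0 at *
  generalize k (p 0) = k0 at *
  have hρ' := hρ.ne'
  -- the curvature condition is this multiple of the claim
  have hfac : ρ ^ 2 * a0 ^ 5 / (4 * (1 - k0 * ρ) ^ 3) *
      (2 * (k2 * a0 + k1 * a1) * (1 - k0 * ρ) + 3 * k1 ^ 2 * a0 * ρ) = 0 := by
    rw [← key]
    clear key
    obtain ⟨m, hmk⟩ : ∃ m, m = 1 - k0 * ρ := ⟨_, rfl⟩
    have hk0 : k0 = (1 - m) / ρ := by
      rw [hmk]
      field_simp
      ring
    rw [← hmk] at hm' ⊢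
    rw [hk0]
    field_simp
    ring
  refine (mul_eq_zero.1 hfac).resolve_left ?_
  positivity

theorem not_locallyConformallyFlat_radial {n : ℕ} (hn : 3 ≤ n) {I : Set ℝ} {a k : ℝ → ℝ}
    (h : IsData I a k) (hk : ∀ t ∈ I, deriv k t ≠ 0) {V : Set (Point n)} (hne : V.Nonempty)
    (hV : V ⊆ radialDomain n I k) : ¬ LocallyConformallyFlat (radial n a k) V := by
  intro hflat
  obtain ⟨p, hp⟩ := hne
  obtain ⟨h0, hρ, hm⟩ := mem_radialDomain_iff.1 (hV hp)
  obtain ⟨U, Φ, hpU, hUV, hΦ⟩ := exists_isNullLift hflat hp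
  have hev := ((eventually_line hΦ.isOpen hpU (spacePart p)).filter_mono
    (nhdsWithin_le_nhds (s := Set.Ioi (0 : ℝ)))).and self_mem_nhdsWithin
  obtain ⟨s, hsU, hs⟩ := hev.exists
  have hs : 0 < s := hs
  have e1 := radial_identity hn h (hUV.trans hV) hΦ hpU
  have e2 := radial_identity hn h (hUV.trans hV) hΦ hsU
  have h1 : (p + s • spacePart p) 0 = p 0 := by simp
  have h2 : radiusSq (p + s • spacePart p) = (1 + s) ^ 2 * radiusSq p := by
    rw [radiusSq_line, spatial_spacePart', spatial_spacePart, spatial_self]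
    ring
  rw [h1, h2] at e2
  have ha := h.pos_a _ h0
  have hk' := hk _ h0
  -- the identity is affine in `r²`, and holds for two values of it
  have h3 : ((1 + s) ^ 2 - 1) * (3 * deriv k (p 0) ^ 2 * a (p 0) * radiusSq p) = 0 := by
    have h4 : ((1 + s) ^ 2 - 1) * (2 * (deriv (deriv k) (p 0) * a (p 0)
        + deriv k (p 0) * deriv a (p 0))) = 0 := by
      linear_combination (1 + s) ^ 2 * e1 - e2
    linear_combination ((1 + s) ^ 2 - 1) * e1 - (1 - k (p 0) * radiusSq p) * h4
  have h5 : (1 + s) ^ 2 - 1 ≠ 0 := by nlinarith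
  have h6 : 3 * deriv k (p 0) ^ 2 * a (p 0) * radiusSq p ≠ 0 := by positivity
  exact mul_ne_zero h5 h6 h3

/-! ### The warped metric is not locally conformally flat -/

/-- The derivative of `S_k` with respect to the radial coordinate, for `k ≠ 0`. -/
noncomputable def dS (k χ : ℝ) : ℝ :=
  if 0 < k then Real.cos (√k * χ) else Real.cosh (√(-k) * χ)

theorem S_of_pos {k : ℝ} (hk : 0 < k) (χ : ℝ) : S k χ = Real.sin (√k * χ) / √k := if_pos hk

theorem S_of_neg {k : ℝ} (hk : k < 0) (χ : ℝ) : S k χ = Real.sinh (√(-k) * χ) / √(-k) := by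
  rw [S, if_neg hk.not_gt, if_neg hk.ne]

theorem dS_of_pos {k : ℝ} (hk : 0 < k) (χ : ℝ) : dS k χ = Real.cos (√k * χ) := if_pos hk

theorem dS_of_neg {k : ℝ} (hk : k < 0) (χ : ℝ) : dS k χ = Real.cosh (√(-k) * χ) :=
  if_neg hk.not_gt

theorem dS_sq_add {k : ℝ} (hk : k ≠ 0) (χ : ℝ) : dS k χ ^ 2 + k * S k χ ^ 2 = 1 := by
  rcases hk.lt_or_gt with hk | hk
  · rw [S_of_neg hk, dS_of_neg hk, div_pow, Real.sq_sqrt (neg_pos.2 hk).le, Real.cosh_sq]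
    field_simp
    ring
  · rw [S_of_pos hk, dS_of_pos hk, div_pow, Real.sq_sqrt hk.le]
    field_simp
    linarith [Real.sin_sq_add_cos_sq (√k * χ)]

theorem hasDerivAt_S {k : ℝ} (hk : k ≠ 0) (χ : ℝ) : HasDerivAt (S k) (dS k χ) χ := by
  rcases hk.lt_or_gt with hk | hk
  · have h0 : √(-k) ≠ 0 := (Real.sqrt_pos.2 (neg_pos.2 hk)).ne'
    rw [dS_of_neg hk, show S k = fun χ => Real.sinh (√(-k) * χ) / √(-k) from funext (S_of_neg hk)]
    refine ((((hasDerivAt_id' χ).const_mul (√(-k))).sinh).div_const (√(-k))).congr_deriv ?_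
    field_simp
  · have h0 : √k ≠ 0 := (Real.sqrt_pos.2 hk).ne'
    rw [dS_of_pos hk, show S k = fun χ => Real.sin (√k * χ) / √k from funext (S_of_pos hk)]
    refine ((((hasDerivAt_id' χ).const_mul (√k)).sin).div_const (√k)).congr_deriv ?_
    field_simp

theorem hasDerivAt_dS {k : ℝ} (hk : k ≠ 0) (χ : ℝ) : HasDerivAt (dS k) (-(k * S k χ)) χ := by
  rcases hk.lt_or_gt with hk | hk
  · have h0 : √(-k) ≠ 0 := (Real.sqrt_pos.2 (neg_pos.2 hk)).ne'
    have h1 := Real.sq_sqrt (neg_pos.2 hk).le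
    rw [S_of_neg hk, show dS k = fun χ => Real.cosh (√(-k) * χ) from funext (dS_of_neg hk)]
    refine (((hasDerivAt_id' χ).const_mul (√(-k))).cosh).congr_deriv ?_
    field_simp
    linear_combination Real.sinh (√(-k) * χ) * h1
  · have h0 : √k ≠ 0 := (Real.sqrt_pos.2 hk).ne'
    have h1 := Real.sq_sqrt hk.le
    rw [S_of_pos hk, show dS k = fun χ => Real.cos (√k * χ) from funext (dS_of_pos hk)]
    refine (((hasDerivAt_id' χ).const_mul (√k)).cos).congr_deriv ?_
    field_simp
    linear_combination -Real.sin (√k * χ) * h1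

theorem hasDerivAt_S_curv {k : ℝ} (hk : k ≠ 0) (χ : ℝ) :
    HasDerivAt (fun κ => S κ χ) ((χ * dS k χ - S k χ) / (2 * k)) k := by
  rcases hk.lt_or_gt with hk | hk
  · have h0 : √(-k) ≠ 0 := (Real.sqrt_pos.2 (neg_pos.2 hk)).ne'
    have h1 := Real.sq_sqrt (neg_pos.2 hk).le
    have hs := (hasDerivAt_id' k).fun_neg.sqrt (neg_pos.2 hk).ne'
    have h2 := ((hs.mul_const χ).sinh).fun_div hs h0
    refine (h2.congr_of_eventuallyEq ?_).congr_deriv ?_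
    · filter_upwards [eventually_lt_nhds hk] with κ hκ using S_of_neg hκ χ
    · rw [dS_of_neg hk, S_of_neg hk]
      have hk' : k = -√(-k) ^ 2 := by rw [h1]; ring
      generalize √(-k) = σ at *
      rw [hk']
      field_simp
      ring
  · have h0 : √k ≠ 0 := (Real.sqrt_pos.2 hk).ne'
    have h1 := Real.sq_sqrt hk.le
    have hs := (hasDerivAt_id' k).sqrt hk.ne'
    have h2 := ((hs.mul_const χ).sin).fun_div hs h0
    refine (h2.congr_of_eventuallyEq ?_).congr_deriv ?_
    · filter_upwards [eventually_gt_nhds hk] with κ hκ using S_of_pos hκ χ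
    · rw [dS_of_pos hk, S_of_pos hk]
      have hk' : k = √k ^ 2 := h1.symm
      generalize √k = σ at *
      rw [hk']
      field_simp

theorem hasDerivAt_dS_curv {k : ℝ} (hk : k ≠ 0) (χ : ℝ) :
    HasDerivAt (fun κ => dS κ χ) (-(χ * S k χ) / 2) k := by
  rcases hk.lt_or_gt with hk | hk
  · have h0 : √(-k) ≠ 0 := (Real.sqrt_pos.2 (neg_pos.2 hk)).ne'
    have hs := (hasDerivAt_id' k).fun_neg.sqrt (neg_pos.2 hk).ne'
    refine (((hs.mul_const χ).cosh).congr_of_eventuallyEq ?_).congr_deriv ?_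
    · filter_upwards [eventually_lt_nhds hk] with κ hκ using dS_of_neg hκ χ
    · rw [S_of_neg hk]
      field_simp
  · have h0 : √k ≠ 0 := (Real.sqrt_pos.2 hk).ne'
    have hs := (hasDerivAt_id' k).sqrt hk.ne'
    refine (((hs.mul_const χ).cos).congr_of_eventuallyEq ?_).congr_deriv ?_
    · filter_upwards [eventually_gt_nhds hk] with κ hκ using dS_of_pos hκ χ
    · rw [S_of_pos hk]
      field_simp

theorem S_pos {k χ : ℝ} (hk : k ≠ 0) (hχ : 0 < χ) (h : 0 < k → χ < Real.pi / √k) :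
    0 < S k χ := by
  rcases hk.lt_or_gt with hk | hk
  · rw [S_of_neg hk]
    have h0 : 0 < √(-k) := Real.sqrt_pos.2 (neg_pos.2 hk)
    exact div_pos (Real.sinh_pos_iff.2 (mul_pos h0 hχ)) h0
  · rw [S_of_pos hk]
    have h0 : 0 < √k := Real.sqrt_pos.2 hk
    have h1 := h hk
    rw [lt_div_iff₀ h0, mul_comm] at h1
    exact div_pos (Real.sin_pos_of_pos_of_lt_pi (mul_pos h0 hχ) h1) h0

/-- An overdetermined system: the algebraic relation is not compatible with the differential
equation, which is that of `y = r S_k'(r) / S_k(r)`. -/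
theorem riccati_contradiction {y : ℝ → ℝ} {k c r₀ : ℝ} (hk : k ≠ 0) (hr₀ : r₀ ≠ 0)
    (hy : ∀ᶠ r in 𝓝 r₀, HasDerivAt y ((y r - y r ^ 2 - k * r ^ 2) / r) r)
    (hE : ∀ᶠ r in 𝓝 r₀, (1 - y r) * (2 + y r + c) - k * r ^ 2 = 0) : False := by
  have hzero : ∀ {f : ℝ → ℝ} {b : ℝ}, (∀ᶠ r in 𝓝 r₀, f r = b) →
      ∀ᶠ r in 𝓝 r₀, HasDerivAt f 0 r := fun h =>
    h.eventually_nhds.mono fun r hr => (hasDerivAt_const r _).congr_of_eventuallyEq hr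
  have hne : ∀ᶠ r in 𝓝 r₀, r ≠ 0 := isOpen_ne.mem_nhds hr₀
  have hsq : ∀ r : ℝ, HasDerivAt (fun r => k * r ^ 2) (k * (2 * r)) r := fun r => by
    simpa using ((hasDerivAt_id' r).fun_pow 2).const_mul k
  -- differentiating the relation and eliminating `k r²` leaves an affine equation for `y`
  have haff : ∀ᶠ r in 𝓝 r₀, 2 * (1 + c) * y r + (2 + c) * (c - 1) = 0 := by
    filter_upwards [hzero hE, hy, hE, hne] with r h0 h1 h2 h3
    have h4 := h0.unique (((h1.const_sub 1).fun_mul ((h1.const_add 2).add_const c)).fun_sub (hsq r))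
    have hD : r * ((y r - y r ^ 2 - k * r ^ 2) / r) = y r - y r ^ 2 - k * r ^ 2 := by
      field_simp
    generalize (y r - y r ^ 2 - k * r ^ 2) / r = D at *
    have h5 : 1 - y r ≠ 0 := fun h => by
      rw [h] at h2
      have : k * r ^ 2 = 0 := by linarith
      simp [hk, h3] at this
    apply mul_left_cancel₀ h5
    linear_combination -r * h4 + (1 + 2 * y r + c) * hD + (2 * y r + c - 1) * h2
  -- hence `y` is constant, unless `c = -1`, when the affine equation reads `-2 = 0`
  have hy' : ∀ᶠ r in 𝓝 r₀, y r - y r ^ 2 - k * r ^ 2 = 0 := by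
    filter_upwards [hzero haff, hy, haff, hne] with r h0 h1 h2 h3
    have h4 := h0.unique ((h1.const_mul (2 * (1 + c))).add_const ((2 + c) * (c - 1)))
    have h5 : 1 + c ≠ 0 := fun h => by
      have : c = -1 := by linarith
      subst this
      norm_num at h2
    refine (mul_eq_zero.1 (?_ : 2 * (1 + c) * (y r - y r ^ 2 - k * r ^ 2) = 0)).resolve_left
      (mul_ne_zero two_ne_zero h5)
    field_simp at h4
    linear_combination -h4
  -- `y` is now locally constant, and so is `k r²`
  have hlast := ((hzero hy').and (hy.and (hy'.and hne))).self_of_nhds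
  obtain ⟨h0, h1, h2, h3⟩ := hlast
  rw [h2, zero_div] at h1
  have h4 := h0.unique ((h1.fun_sub (h1.fun_pow 2)).fun_sub (hsq r₀))
  simp [hk, h3] at h4

/-- The derivative of `S_k` with respect to the curvature `k ≠ 0`. -/
noncomputable def kS (k χ : ℝ) : ℝ := (χ * dS k χ - S k χ) / (2 * k)

theorem hasDerivAt_kS_curv {k : ℝ} (hk : k ≠ 0) (χ : ℝ) :
    HasDerivAt (fun κ => kS κ χ)
      (-(χ ^ 2 * S k χ + 2 * kS k χ) / (4 * k) - kS k χ / k) k := by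
  have h2 : (2 : ℝ) * k ≠ 0 := mul_ne_zero two_ne_zero hk
  refine ((((hasDerivAt_dS_curv hk χ).const_mul χ).fun_sub (hasDerivAt_S_curv hk χ)).fun_div
    ((hasDerivAt_id' k).const_mul 2) h2).congr_deriv ?_
  unfold kS
  field_simp
  ring

/-- The coefficients of the warped metric, on the set where `k ≠ 0`, so that the three cases in the
definition of `S_k` do not meet. -/
theorem isSpherical_warped {n : ℕ} {I : Set ℝ} {a k : ℝ → ℝ} (h : IsData I a k)
    {U : Set (Point n)} (hU : U ⊆ warpedDomain n I k) (hk : ∀ q ∈ U, k (q 0) ≠ 0) :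
    IsSpherical (warped n a k) U
      (fun t ρ => a t ^ 2 * S (k t) √ρ ^ 2 / ρ)
      (fun t ρ => (a t ^ 2 - a t ^ 2 * S (k t) √ρ ^ 2 / ρ) / ρ)
      (fun t ρ => 2 * a t * S (k t) √ρ *
        (deriv a t * S (k t) √ρ + a t * (kS (k t) √ρ * deriv k t)) / ρ)
      (fun t ρ => a t ^ 2 * S (k t) √ρ * (√ρ * dS (k t) √ρ - S (k t) √ρ) / ρ ^ 2)
      (fun t ρ => (2 * a t * deriv a t - 2 * a t * S (k t) √ρ *
        (deriv a t * S (k t) √ρ + a t * (kS (k t) √ρ * deriv k t)) / ρ) / ρ)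
      (fun t ρ => (-(a t ^ 2 * S (k t) √ρ * (√ρ * dS (k t) √ρ - S (k t) √ρ) / ρ ^ 2) * ρ
        - (a t ^ 2 - a t ^ 2 * S (k t) √ρ ^ 2 / ρ)) / ρ ^ 2) := by
  have hr : ∀ q ∈ U, radiusSq q ≠ 0 := fun q hq => by
    rw [← radius_sq]
    exact pow_ne_zero 2 (hU hq).2.1.ne'
  have hrad : ∀ q : Point n, √(radiusSq q) = radius q := fun q => rfl
  have hut : ∀ q ∈ U, HasDerivAt (fun t => a t ^ 2 * S (k t) √(radiusSq q) ^ 2 / radiusSq q)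
      (2 * a (q 0) * S (k (q 0)) √(radiusSq q) *
        (deriv a (q 0) * S (k (q 0)) √(radiusSq q)
          + a (q 0) * (kS (k (q 0)) √(radiusSq q) * deriv k (q 0))) / radiusSq q) (q 0) := by
    intro q hq
    have h0 := (hU hq).1
    refine ((((h.hasDerivAt_a h0).fun_pow 2).fun_mul
      (((hasDerivAt_S_curv (hk q hq) √(radiusSq q)).comp (q 0)
        (h.hasDerivAt_k h0)).fun_pow 2)).div_const (radiusSq q)).congr_deriv ?_
    simp only [Function.comp_apply, kS]
    norm_num
    ring
  have hur : ∀ q ∈ U, HasDerivAt (fun ρ => a (q 0) ^ 2 * S (k (q 0)) √ρ ^ 2 / ρ)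
      (a (q 0) ^ 2 * S (k (q 0)) √(radiusSq q) * (√(radiusSq q) * dS (k (q 0)) √(radiusSq q)
        - S (k (q 0)) √(radiusSq q)) / radiusSq q ^ 2) (radiusSq q) := by
    intro q hq
    refine ((((((hasDerivAt_S (hk q hq) √(radiusSq q)).comp (radiusSq q)
      (Real.hasDerivAt_sqrt (hr q hq))).fun_pow 2).const_mul (a (q 0) ^ 2)).fun_div
      (hasDerivAt_id' (radiusSq q)) (hr q hq))).congr_deriv ?_
    have h1 := (hU hq).2.1.ne'
    simp only [Function.comp_apply]
    rw [hrad, ← radius_sq]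
    generalize radius q = r at *
    field_simp
    norm_num
    ring
  refine ⟨fun q hq v v' => ?_, hut, hur, fun q hq => ?_, fun q hq => ?_⟩
  · have h1 := (hU hq).2.1.ne'
    rw [warped, dr_mul_dr, sphereMetric_eq, spherical, hrad, ← radius_sq]
    field_simp
    ring
  · refine ((((h.hasDerivAt_a (hU hq).1).fun_pow 2).fun_sub (hut q hq)).div_const
      (radiusSq q)).congr_deriv ?_
    norm_num
  · refine (((hur q hq).const_sub (a (q 0) ^ 2)).fun_div (hasDerivAt_id' (radiusSq q))
      (hr q hq)).congr_deriv ?_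
    rw [mul_one]

/-- The curvature condition for the warped metric, in terms of the logarithmic derivative
`y = r S_k'(r) / S_k(r)`. At a fixed time, all other quantities than `y` and `r` are constants. -/
theorem warped_identity {n : ℕ} (hn : 3 ≤ n) {I : Set ℝ} {a k : ℝ → ℝ} (h : IsData I a k)
    (hk' : ∀ t ∈ I, deriv k t ≠ 0)
    {F : Type*} [NormedAddCommGroup F] [NormedSpace ℝ F] [FiniteDimensional ℝ F]
    {B : F →L[ℝ] F →L[ℝ] ℝ} {Φ : Point n → F} {U : Set (Point n)}
    (hU : U ⊆ warpedDomain n I k) (hk : ∀ q ∈ U, k (q 0) ≠ 0)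
    (hΦ : IsNullLift B Φ (warped n a k) U) {p : Point n} (hp : p ∈ U) :
    let y := radius p * dS (k (p 0)) (radius p) / S (k (p 0)) (radius p)
    (1 - y) * (2 + y - 2 * k (p 0) * (deriv (deriv k) (p 0) + deriv k (p 0) * deriv a (p 0)
      / a (p 0)) / deriv k (p 0) ^ 2) - k (p 0) * radius p ^ 2 = 0 := by
  intro y
  obtain ⟨h0, hr, hlt⟩ := hU hp
  have hk0 := hk p hp
  have hρ : radiusSq p = radius p ^ 2 := (radius_sq p).symm
  have hk1 := h.hasDerivAt_k h0
  have ha1 := h.hasDerivAt_a h0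
  have hk2 := hasDerivAt_deriv_of_contDiffOn h.isOpen h.smooth_k h0
  have ha2 := hasDerivAt_deriv_of_contDiffOn h.isOpen h.smooth_a h0
  have ha0 := (h.pos_a _ h0).ne'
  have hk1' := hk' _ h0
  have hS0 := (S_pos hk0 hr hlt).ne'
  have hr0 := hr.ne'
  have hunit := dS_sq_add hk0 (radius p)
  have hsr : √(radius p ^ 2) = radius p := Real.sqrt_sq hr.le
  have hs := (hasDerivAt_S_curv hk0 (radius p)).comp (p 0) hk1
  have hks := (hasDerivAt_kS_curv hk0 (radius p)).comp (p 0) hk1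
  have hutt := (((ha1.const_mul 2).fun_mul hs).fun_mul
    ((ha2.fun_mul hs).fun_add (ha1.fun_mul (hks.fun_mul hk2)))).div_const (radius p ^ 2)
  have hwtt := (((ha1.const_mul 2).fun_mul ha2).fun_sub hutt).div_const (radius p ^ 2)
  have hSr : HasDerivAt (fun ρ => S (k (p 0)) √ρ) (dS (k (p 0)) (radius p) / (2 * radius p))
      (radius p ^ 2) := by
    refine (HasDerivAt.comp (radius p ^ 2) (h₂ := S (k (p 0))) (by
      rw [hsr]
      exact hasDerivAt_S hk0 _) (Real.hasDerivAt_sqrt (pow_ne_zero 2 hr0))).congr_deriv ?_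
    rw [hsr]
    ring
  have hdSr : HasDerivAt (fun ρ => dS (k (p 0)) √ρ)
      (-(k (p 0) * S (k (p 0)) (radius p)) / (2 * radius p)) (radius p ^ 2) := by
    refine (HasDerivAt.comp (radius p ^ 2) (h₂ := dS (k (p 0))) (by
      rw [hsr]
      exact hasDerivAt_dS hk0 _) (Real.hasDerivAt_sqrt (pow_ne_zero 2 hr0))).congr_deriv ?_
    rw [hsr]
    ring
  have hsqrt : HasDerivAt (fun ρ => √ρ) (1 / (2 * radius p)) (radius p ^ 2) := by
    simpa only [hsr] using Real.hasDerivAt_sqrt (pow_ne_zero 2 hr0)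
  have hρ2 : HasDerivAt (fun ρ : ℝ => ρ ^ 2) (2 * radius p ^ 2) (radius p ^ 2) := by
    simpa using hasDerivAt_pow 2 (radius p ^ 2)
  have hurr := ((hSr.const_mul (a (p 0) ^ 2)).fun_mul ((hsqrt.fun_mul hdSr).fun_sub hSr)).fun_div
    hρ2 (pow_ne_zero 2 (pow_ne_zero 2 hr0))
  have hwrc : ContinuousAt (fun ρ => (-(a (p 0) ^ 2 * S (k (p 0)) √ρ *
      (√ρ * dS (k (p 0)) √ρ - S (k (p 0)) √ρ) / ρ ^ 2) * ρ
        - (a (p 0) ^ 2 - a (p 0) ^ 2 * S (k (p 0)) √ρ ^ 2 / ρ)) / ρ ^ 2) (radius p ^ 2) := by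
    have c1 := hSr.continuousAt
    have c2 := hdSr.continuousAt
    have c3 := pow_ne_zero 2 hr0
    fun_prop (disch := positivity)
  have key := hΦ.spherical_identity hn (isSpherical_warped h hU hk) hp hρ rfl rfl rfl rfl rfl
    rfl (by simp only [hsr]; exact hutt) (by simp only [hsr]; exact hwtt) hurr hwrc
    (Q := a (p 0) ^ 2) (by field_simp; ring) (pow_ne_zero 2 hr0)
    (by rw [hsr]; positivity) (pow_ne_zero 2 ha0)
  simp only [hsr, Function.comp_apply] at key
  rw [← sub_eq_zero] at key
  clear hutt hwtt hurr hwrc hSr hdSr hsqrt hρ2 hs hks hk1 hk2 ha1 ha2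
  have hkS : kS (k (p 0)) (radius p) = (y - 1) * S (k (p 0)) (radius p) / (2 * k (p 0)) := by
    simp only [kS, y]
    field_simp
  have hdS : dS (k (p 0)) (radius p) = y * S (k (p 0)) (radius p) / radius p := by
    simp only [y]
    field_simp
  rw [hkS] at key
  rw [hdS] at key hunit
  generalize y = y at *
  generalize deriv (deriv k) (p 0) = k2 at *
  generalize deriv k (p 0) = k1 at *
  generalize deriv (deriv a) (p 0) = a2 at *
  generalize deriv a (p 0) = a1 at *
  generalize a (p 0) = A at *
  generalize S (k (p 0)) (radius p) = s at *
  generalize k (p 0) = K at *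
  generalize radius p = r at *
  -- the curvature condition is this multiple of the claim, modulo the relation `S'² + k S² = 1`
  have hfac : A ^ 6 * s ^ 4 * k1 ^ 2 / (4 * K ^ 2 * r ^ 2) *
      ((1 - y) * (2 + y - 2 * K * (k2 + k1 * a1 / A) / k1 ^ 2) - K * r ^ 2) = 0 := by
    have hunit' : A ^ 4 * s ^ 2 / r ^ 2 * ((y * s / r) ^ 2 + K * s ^ 2 - 1) = 0 := by
      rw [hunit, sub_self, mul_zero]
    linear_combination (norm := skip) -key - hunit'
    clear key hunit hunit'
    field_simp
    ring
  refine (mul_eq_zero.1 hfac).resolve_left ?_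
  positivity

theorem not_locallyConformallyFlat_warped {n : ℕ} (hn : 3 ≤ n) {I : Set ℝ} {a k : ℝ → ℝ}
    (h : IsData I a k) (hk : ∀ t ∈ I, deriv k t ≠ 0) {V : Set (Point n)} (hVo : IsOpen V)
    (hne : V.Nonempty) (hV : V ⊆ warpedDomain n I k) :
    ¬ LocallyConformallyFlat (warped n a k) V := by
  intro hflat
  obtain ⟨p₀, hp₀⟩ := hne
  -- since `k` is not stationary, some point of `V` has `k ≠ 0`
  obtain ⟨p, hp, hkp⟩ : ∃ p ∈ V, k (p 0) ≠ 0 := by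
    have h0 := (hV hp₀).1
    have h1 : ∀ᶠ t in 𝓝[≠] (p₀ 0), k t ≠ 0 :=
      (h.hasDerivAt_k h0).eventually_ne (hk _ h0)
    have h2 : Tendsto (fun s : ℝ => p₀ 0 + s) (𝓝[≠] 0) (𝓝[≠] (p₀ 0)) := by
      refine tendsto_nhdsWithin_of_tendsto_nhds_of_eventually_within _ ?_ ?_
      · refine Tendsto.mono_left ?_ nhdsWithin_le_nhds
        have : ContinuousAt (fun s : ℝ => p₀ 0 + s) 0 := by fun_prop
        simpa [ContinuousAt] using this
      · filter_upwards [self_mem_nhdsWithin] with s hs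
        simpa using hs
    obtain ⟨s, hs1, hs2⟩ := ((h2.eventually h1).and
      ((eventually_line hVo hp₀ (timeVec n)).filter_mono nhdsWithin_le_nhds)).exists
    exact ⟨_, hs2, by simpa using hs1⟩
  obtain ⟨h0, hr, hlt⟩ := hV hp
  obtain ⟨U, Φ, hpU, hUV, hΦ⟩ := exists_isNullLift hflat hp
  have hUI : ∀ q ∈ U, q 0 ∈ I := fun q hq => (hV (hUV hq)).1
  have hopen : IsOpen (U ∩ {q | k (q 0) ≠ 0}) := by
    have hc : ContinuousOn (fun q : Point n => k (q 0)) U :=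
      h.smooth_k.continuousOn.comp (continuous_apply 0).continuousOn hUI
    exact hc.isOpen_inter_preimage hΦ.isOpen isOpen_ne
  have hΦ' := hΦ.mono hopen Set.inter_subset_left
  -- the radial line through `p`, on which the time is constant, is parametrized by `r`
  have hline : ∀ s : ℝ, 0 < 1 + s → radius (p + s • spacePart p) = (1 + s) * radius p := by
    intro s hs
    rw [radius_eq, radius_eq, radiusSq_line, spatial_spacePart', spatial_spacePart, spatial_self,
      show radiusSq p + 2 * s * radiusSq p + s ^ 2 * radiusSq p = (1 + s) ^ 2 * radiusSq p by ring,
      Real.sqrt_mul (sq_nonneg _), Real.sqrt_sq hs.le]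
  set κ := k (p 0) with hκ
  have hs : Tendsto (fun r : ℝ => r / radius p - 1) (𝓝 (radius p)) (𝓝 0) := by
    have h1 : ContinuousAt (fun r : ℝ => r / radius p - 1) (radius p) := by fun_prop
    simpa [ContinuousAt, hr.ne'] using h1
  have hpos : ∀ᶠ r in 𝓝 (radius p), 0 < r := eventually_gt_nhds hr
  have hU : ∀ᶠ r in 𝓝 (radius p), p + (r / radius p - 1) • spacePart p ∈
      U ∩ {q | k (q 0) ≠ 0} := hs.eventually (eventually_line hopen ⟨hpU, hkp⟩ _)
  have hrad : ∀ r : ℝ, 0 < r → radius (p + (r / radius p - 1) • spacePart p) = r := by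
    intro r hr'
    rw [hline _ (by rw [add_sub_cancel]; positivity)]
    field_simp
    ring
  have hzero : ∀ s : ℝ, (p + s • spacePart p) 0 = p 0 := fun s => by simp
  refine riccati_contradiction (y := fun r => r * dS κ r / S κ r) (k := κ) (r₀ := radius p)
    (c := -(2 * κ * (deriv (deriv k) (p 0) + deriv k (p 0) * deriv a (p 0) / a (p 0))
      / deriv k (p 0) ^ 2)) hkp hr.ne' ?_ ?_
  · filter_upwards [hU, hpos] with r hrU hr'
    obtain ⟨-, -, h1⟩ := hV (hUV hrU.1)
    rw [hzero, hrad r hr', ← hκ] at h1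
    have hS := (S_pos hkp hr' h1).ne'
    have hr0 := hr'.ne'
    refine (((hasDerivAt_id' r).fun_mul (hasDerivAt_dS hkp r)).fun_div (hasDerivAt_S hkp r)
      hS).congr_deriv ?_
    field_simp
    ring
  · filter_upwards [hU, hpos] with r hrU hr'
    have h1 := warped_identity hn h hk (Set.inter_subset_left.trans (hUV.trans hV))
      (fun q hq => hq.2) hΦ' hrU
    simp only [hzero, hrad r hr', ← hκ] at h1
    linear_combination h1

end KMetric

theorem mainTheorem9 (n : ℕ) (hn : 3 ≤ n)
    (I₁ : Set ℝ) (a₁ k₁ : ℝ → ℝ) (h₁ : KMetric.IsData I₁ a₁ k₁)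
    (I₂ : Set ℝ) (a₂ k₂ : ℝ → ℝ) (h₂ : KMetric.IsData I₂ a₂ k₂)
    (hk₂ : ∀ t ∈ I₂, deriv k₂ t ≠ 0) :
    -- no local isometry between the conformal metric and the radial or the warped metric
    (¬ KMetric.HasLocalIsometry
        (KMetric.conformal n a₁ k₁) (KMetric.conformalDomain n I₁ k₁)
        (KMetric.radial n a₂ k₂) (KMetric.radialDomain n I₂ k₂)) ∧
    (¬ KMetric.HasLocalIsometry
        (KMetric.conformal n a₁ k₁) (KMetric.conformalDomain n I₁ k₁)
        (KMetric.warped n a₂ k₂) (KMetric.warpedDomain n I₂ k₂)) ∧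
    -- the conformal metric is locally conformally flat and its Weyl tensor vanishes identically
    KMetric.LocallyConformallyFlat
        (KMetric.conformal n a₁ k₁) (KMetric.conformalDomain n I₁ k₁) ∧
    (∀ p ∈ KMetric.conformalDomain n I₁ k₁, ∀ a b c d : Fin (n + 1),
        KMetric.weyl (KMetric.conformal n a₁ k₁) a b c d p = 0) ∧
    -- the radial and the warped metric are not locally conformally flat on any open subset
    (∀ V : Set (KMetric.Point n), IsOpen V → V.Nonempty → V ⊆ KMetric.radialDomain n I₂ k₂ →
        ¬ KMetric.LocallyConformallyFlat (KMetric.radial n a₂ k₂) V) ∧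
    (∀ V : Set (KMetric.Point n), IsOpen V → V.Nonempty → V ⊆ KMetric.warpedDomain n I₂ k₂ →
        ¬ KMetric.LocallyConformallyFlat (KMetric.warped n a₂ k₂) V) := by
  have hflat := KMetric.locallyConformallyFlat_conformal n h₁
  refine ⟨?_, ?_, hflat, fun p hp => KMetric.weyl_eq_zero_of_locallyConformallyFlat hn hflat hp,
    fun V _ hne hV => KMetric.not_locallyConformallyFlat_radial hn h₂ hk₂ hne hV,
    fun V hVo hne hV => KMetric.not_locallyConformallyFlat_warped hn h₂ hk₂ hVo hne hV⟩
  · rintro ⟨φ, hφ, hne, hsrc, htgt, hiso⟩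
    exact KMetric.not_locallyConformallyFlat_radial hn h₂ hk₂
      (hne.image φ |>.mono (φ.image_source_eq_target).subset) htgt (hflat.of_isometry hφ hsrc hiso)
  · rintro ⟨φ, hφ, hne, hsrc, htgt, hiso⟩
    exact KMetric.not_locallyConformallyFlat_warped hn h₂ hk₂ φ.open_target
      (hne.image φ |>.mono (φ.image_source_eq_target).subset) htgt (hflat.of_isometry hφ hsrc hiso)
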